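/- Let $n,m\ge 1$. A weight on $\mathbb{R}^n$ is a nonnegative locally integrable function; cubes are cubes in $\mathbb{R}^n$ with sides parallel to the coordinate axes, and $u(Q)=\int_Q u\,dx$. For $\vec g=(g_1,\dots,g_m)$ put $$\mathcal M(\vec g)(x)=\sup_{Q\ni x}\prod_{i=1}^m\frac1{|Q|}\int_Q|g_i(y)|\,dy,$$ the supremum being over all cubes $Q$ containing $x$. Let $1<p_1,\dots,p_m<\infty$, let $\frac1p=\frac1{p_1}+\dots+\frac1{p_m}$, and write $\vec P=(p_1,\dots,p_m)$ and $p_i'=p_i/(p_i-1)$. For nonnegative functions $v$ and almost everywhere positive functions $u_1,\dots,u_m$, with $\vec u=(u_1,\dots,u_m)$, put $$[v,\vec u]_{B_{\vec P}}=\sup_Q\frac{v(Q)}{|Q|}\Big(\prod_{i=1}^m\frac{u_i(Q)}{|Q|}\Big)^p\exp\Big(\frac1{|Q|}\int_Q\log\prod_{i=1}^m u_i^{-p/p_i}\,dx\Big)\in[0,\infty],$$ the supremum being over all cubes $Q$; the constant is understood to be $\infty$ if $v$ or one of the $u_i$ is not locally integrable, or if the logarithm is not integrable over some cube. Then there is a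 constant $C<\infty$, depending only on $n$, $m$ and $\vec P$, such that for all weights $v,w_1,\dots,w_m$ with $w_i>0$ almost everywhere, with $\sigma_i=w_i^{1-p_i'}$ and $\vec\sigma=(\sigma_1,\dots,\sigma_m)$, and for all $f_i\in L^{p_i}(\sigma_i)$, $i=1,\dots,m$, $$\|\mathcal M(f_1\sigma_1,\dots,f_m\sigma_m)\|_{L^p(v)}\le C\,[v,\vec\sigma]_{B_{\vec P}}^{1/p}\prod_{i=1}^m\|f_i\|_{L^{p_i}(\sigma_i)}.$$ On the right-hand side $\infty\cdot 0=0$. -/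

import Mathlib

namespace MultiWeight

open MeasureTheory

/-- The closed cube in `ℝⁿ` with sides parallel to the axes, lower corner `a` and side length `ℓ`.
(`ℝⁿ` is `Fin n → ℝ` with Lebesgue measure; its norm is never used.) -/
def cube {n : ℕ} (a : Fin n → ℝ) (ℓ : ℝ) : Set (Fin n → ℝ) :=
  Set.Icc a (fun j => a j + ℓ)

/-- A weight on `ℝⁿ`: a nonnegative locally integrable function. -/
structure IsWeight {n : ℕ} (w : (Fin n → ℝ) → ℝ) : Prop where
  locallyIntegrable : LocallyIntegrable w volume
  nonneg : ∀ᵐ x, 0 ≤ w x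

/-- The measure `w(x) dx`, so that `L^p(w)` is the `L^p` space of this measure. -/
noncomputable def weightMeasure {n : ℕ} (w : (Fin n → ℝ) → ℝ) : Measure (Fin n → ℝ) :=
  volume.withDensity (fun x => ENNReal.ofReal (w x))

/-- The multi(sub)linear maximal function
`𝓜(g₁, …, g_m)(x) = sup_{Q ∋ x} ∏ᵢ (1/|Q|) ∫_Q |gᵢ|`, the supremum being over all cubes `Q`
containing `x`. -/
noncomputable def maximalFunction {n m : ℕ} (g : Fin m → (Fin n → ℝ) → ℂ)
    (x : Fin n → ℝ) : ENNReal :=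
  ⨆ (a : Fin n → ℝ) (ℓ : ℝ) (_ : 0 < ℓ) (_ : x ∈ cube a ℓ),
    ∏ i, (∫⁻ y in cube a ℓ, ‖g i y‖ₑ) / volume (cube a ℓ)

/-- The dual weight `σ = w^{1 - q'}` where `q' = q / (q - 1)`. -/
noncomputable def dualWeight {n : ℕ} (q : ℝ) (w : (Fin n → ℝ) → ℝ) (x : Fin n → ℝ) : ℝ :=
  w x ^ (1 - q.conjExponent)

open Classical in
/-- The quantity
`(v(Q)/|Q|) (∏ᵢ uᵢ(Q)/|Q|)^p exp ((1/|Q|) ∫_Q log ∏ᵢ uᵢ^{-p/pᵢ})` for functions `v ≥ 0`, `uᵢ > 0`.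
It is `∞` if `v(Q)` or some `uᵢ(Q)` is infinite (then one of the functions is not a weight).
If these are all finite, the mean of the logarithm exists in `(-∞, ∞]`, and it equals `+∞` exactly
when the logarithm is not integrable over `Q`; the quantity is `∞` in that case too. -/
noncomputable def bumpQuantity {n m : ℕ} (p : ℝ) (P : Fin m → ℝ) (v : (Fin n → ℝ) → ℝ)
    (u : Fin m → (Fin n → ℝ) → ℝ) (Q : Set (Fin n → ℝ)) : ENNReal :=
  if IntegrableOn v Q ∧ (∀ i, IntegrableOn (u i) Q) ∧
      IntegrableOn (fun x => Real.log (∏ i, u i x ^ (-p / P i))) Q then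
    ENNReal.ofReal ((⨍ x in Q, v x) * (∏ i, ⨍ x in Q, u i x) ^ p *
      Real.exp (⨍ x in Q, Real.log (∏ i, u i x ^ (-p / P i))))
  else ⊤

/-- The multilinear `B` constant `[v, u]_{B_P}`: the supremum over all cubes. -/
noncomputable def bumpConstant {n m : ℕ} (p : ℝ) (P : Fin m → ℝ) (v : (Fin n → ℝ) → ℝ)
    (u : Fin m → (Fin n → ℝ) → ℝ) : ENNReal :=
  ⨆ (a : Fin n → ℝ) (ℓ : ℝ) (_ : 0 < ℓ), bumpQuantity p P v u (cube a ℓ)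

end MultiWeight

/-! The cubes are first replaced by finitely many members of a translated dyadic grid, so that any
two are nested or disjoint. Write `s i` for `σ_i`, `F i` for `|f_i|`, and `T Q` for the product of
the averages of `s i * F i`. Each average factors as the average of `s i` times the average of `F i`
against `σ_i dx`.

The weight condition is used through Jensen: the inverse of its exponential factor is at most the
square of the average of `h = (∏ s_i^{p/p_i})^{1/2}`. Hence `T Q ^ p * V Q` is at most `B` times
`|Q|` times the square of `(avg h) · (∏ avg F_i)^{p/2}`. On `Q` each average of `F i` lies below the
weighted maximal function `M i`, so this last product is at most the average over `Q` of `H = (∏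
s_i^{p/p_i} M_i^p)^{1/2}`.

A sparse subfamily (`exists_sparse_subfamily`) dominates the maximal function and makes the sum of
`(avg H)^2 |Q|` at most a multiple of the `L^2` norm squared of the unweighted maximal function of
`H`, hence of `∫ H^2`. Hölder with exponents `p_i / p` and the maximal inequality in each
`L^{p_i}(σ_i)` finish (`lintegral_prod_familyMax_le`). The latter holds for the measures `σ_i dx`
without doubling, because the family is laminar. The argument works with `p`-th powers throughout,
so `p < 1` is no obstacle. -/

namespace MultiWeight

open MeasureTheory Set
open scoped ENNReal

/-! ### Maximal functions over finite laminar families, for arbitrary measures. -/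

section LaminarFamilies

variable {X : Type*}

/-- A family of sets in which any two members are nested or disjoint. -/
def IsLaminar (𝒟 : Set (Set X)) : Prop :=
  ∀ Q ∈ 𝒟, ∀ R ∈ 𝒟, Q ⊆ R ∨ R ⊆ Q ∨ Disjoint Q R

theorem IsLaminar.mono {𝒟 ℰ : Set (Set X)} (h : IsLaminar 𝒟) (hsub : ℰ ⊆ 𝒟) : IsLaminar ℰ :=
  fun Q hQ R hR => h Q (hsub hQ) R (hsub hR)

theorem IsLaminar.exists_disjoint_subfamily {𝒟 : Finset (Set X)}
    (h : IsLaminar (𝒟 : Set (Set X))) :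
    ∃ ℱ ⊆ 𝒟, (ℱ : Set (Set X)).PairwiseDisjoint id ∧ ∀ Q ∈ 𝒟, ∃ R ∈ ℱ, Q ⊆ R := by
  classical
  refine ⟨𝒟.filter (fun Q => Maximal (· ∈ 𝒟) Q), Finset.filter_subset _ _, ?_, ?_⟩
  · intro Q hQ R hR hne
    simp only [Finset.coe_filter, mem_ofPred_eq] at hQ hR
    rcases h Q hQ.1 R hR.1 with h' | h' | h'
    · exact absurd (hQ.2.eq_of_le hR.1 h') hne
    · exact absurd (hR.2.eq_of_le hQ.1 h').symm hne
    · exact h'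
  · intro Q hQ
    obtain ⟨R, hQR, hR⟩ := 𝒟.exists_le_maximal hQ
    exact ⟨R, by simp [hR.prop, hR], hQR⟩

theorem le_iSup_indicator_const {𝒟 : Finset (Set X)} (c : Set X → ℝ≥0∞) {Q : Set X} (hQ : Q ∈ 𝒟)
    {x : X} (hx : x ∈ Q) : c Q ≤ ⨆ Q ∈ 𝒟, Q.indicator (fun _ => c Q) x := by
  refine le_trans ?_ (le_iSup₂ (f := fun Q (_ : Q ∈ 𝒟) => Q.indicator (fun _ => c Q) x) Q hQ)
  rw [indicator_of_mem hx]

theorem lt_iSup_indicator_const_iff {𝒟 : Finset (Set X)} {c : Set X → ℝ≥0∞} {x : X} {t : ℝ≥0∞} :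
    t < ⨆ Q ∈ 𝒟, Q.indicator (fun _ => c Q) x ↔ ∃ Q ∈ 𝒟, x ∈ Q ∧ t < c Q := by
  classical
  simp only [lt_iSup_iff, indicator_apply]
  constructor
  · rintro ⟨Q, hQ, hlt⟩
    by_cases hx : x ∈ Q
    · exact ⟨Q, hQ, hx, by simpa [hx] using hlt⟩
    · simp [hx] at hlt
  · rintro ⟨Q, hQ, hx, hlt⟩
    exact ⟨Q, hQ, by simpa [hx] using hlt⟩

variable [MeasurableSpace X]

/-- The maximal function of `h` with respect to the measure `ν`, the averages being over the
members of a finite family of sets. -/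
noncomputable def familyMax (ν : Measure X) (𝒟 : Finset (Set X)) (h : X → ℝ≥0∞) (x : X) : ℝ≥0∞ :=
  ⨆ Q ∈ 𝒟, Q.indicator (fun _ => ⨍⁻ y in Q, h y ∂ν) x

theorem measurable_iSup_indicator_const {𝒟 : Finset (Set X)} (hm : ∀ Q ∈ 𝒟, MeasurableSet Q)
    (c : Set X → ℝ≥0∞) : Measurable (fun x => ⨆ Q ∈ 𝒟, Q.indicator (fun _ => c Q) x) :=
  Measurable.biSup _ 𝒟.countable_toSet fun Q hQ => measurable_const.indicator (hm Q hQ)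

theorem measurable_familyMax {ν : Measure X} {𝒟 : Finset (Set X)}
    (hm : ∀ Q ∈ 𝒟, MeasurableSet Q) (h : X → ℝ≥0∞) : Measurable (familyMax ν 𝒟 h) :=
  measurable_iSup_indicator_const hm _

theorem setLAverage_le_familyMax {ν : Measure X} {𝒟 : Finset (Set X)} (h : X → ℝ≥0∞) {Q : Set X}
    (hQ : Q ∈ 𝒟) {x : X} (hx : x ∈ Q) : ⨍⁻ y in Q, h y ∂ν ≤ familyMax ν 𝒟 h x :=
  le_iSup_indicator_const (fun Q => ⨍⁻ y in Q, h y ∂ν) hQ hx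

/-- The level set is the disjoint union of the maximal members whose average exceeds `t`. No
covering constant is lost, which is why no doubling of `ν` is needed. -/
theorem mul_measure_lt_familyMax_le {ν : Measure X} {𝒟 : Finset (Set X)}
    (hlam : IsLaminar (𝒟 : Set (Set X))) (hm : ∀ Q ∈ 𝒟, MeasurableSet Q) (h : X → ℝ≥0∞)
    (t : ℝ≥0∞) :
    t * ν {x | t < familyMax ν 𝒟 h x} ≤ ∫⁻ x in {x | t < familyMax ν 𝒟 h x}, h x ∂ν := by
  classical
  have hlam' : IsLaminar ((𝒟.filter fun Q => t < ⨍⁻ y in Q, h y ∂ν : Finset (Set X)) : Set _) :=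
    hlam.mono (by exact_mod_cast Finset.filter_subset _ _)
  obtain ⟨ℱ, hsub, hdisj, hcov⟩ := hlam'.exists_disjoint_subfamily
  have hset : {x | t < familyMax ν 𝒟 h x} = ⋃ Q ∈ ℱ, Q := by
    ext x
    simp only [mem_ofPred_eq, familyMax, lt_iSup_indicator_const_iff, mem_iUnion, exists_prop]
    constructor
    · rintro ⟨Q, hQ, hx, hlt⟩
      obtain ⟨R, hR, hQR⟩ := hcov Q (by simp [hQ, hlt])
      exact ⟨R, hR, hQR hx⟩
    · rintro ⟨Q, hQ, hx⟩
      have := Finset.mem_filter.1 (hsub hQ)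
      exact ⟨Q, this.1, hx, this.2⟩
  have hmF : ∀ Q ∈ ℱ, MeasurableSet Q := fun Q hQ => hm Q (Finset.mem_filter.1 (hsub hQ)).1
  have hsum : ∫⁻ x in ⋃ Q ∈ ℱ, Q, h x ∂ν = ∑ Q ∈ ℱ, ∫⁻ x in Q, h x ∂ν :=
    lintegral_biUnion_finset hdisj hmF h
  rw [hset, hsum]
  calc t * ν (⋃ Q ∈ ℱ, Q) ≤ t * ∑ Q ∈ ℱ, ν Q := by
        gcongr; exact measure_biUnion_finset_le _ _
    _ = ∑ Q ∈ ℱ, t * ν Q := Finset.mul_sum _ _ _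
    _ ≤ ∑ Q ∈ ℱ, ∫⁻ x in Q, h x ∂ν := by
        refine Finset.sum_le_sum fun Q hQ => ENNReal.mul_le_of_le_div ?_
        have := (Finset.mem_filter.1 (hsub hQ)).2.le
        rwa [setLAverage_eq] at this

theorem le_one_add_rpow {q : ℝ} (hq : 1 ≤ q) (x : ℝ≥0∞) : x ≤ 1 + x ^ q := by
  rcases le_total x 1 with h | h
  · exact h.trans le_self_add
  · calc x = x ^ (1 : ℝ) := (ENNReal.rpow_one x).symm
      _ ≤ x ^ q := ENNReal.rpow_le_rpow_of_exponent_le h hq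
      _ ≤ _ := le_add_self

theorem setLIntegral_ne_top_of_rpow {ν : Measure X} {q : ℝ} (hq : 1 ≤ q) {h : X → ℝ≥0∞}
    (hfin : ∫⁻ x, h x ^ q ∂ν ≠ ∞) {Q : Set X} (hQ : ν Q ≠ ∞) : ∫⁻ x in Q, h x ∂ν ≠ ∞ := by
  refine ne_top_of_le_ne_top (ENNReal.add_ne_top.2 ⟨hQ, hfin⟩) ?_
  calc ∫⁻ x in Q, h x ∂ν ≤ ∫⁻ x in Q, (1 + h x ^ q) ∂ν :=
        lintegral_mono fun x => le_one_add_rpow hq _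
    _ = ν Q + ∫⁻ x in Q, h x ^ q ∂ν := by
        rw [lintegral_add_left measurable_const]; simp
    _ ≤ _ := by gcongr; exact Measure.restrict_le_self

/-- Absorption step for the maximal inequality: the power of `x` on the right is divided out, which
requires `x` to be finite. -/
theorem le_mul_of_le_mul_rpow_mul_rpow {q : ℝ} (hq : 1 < q) {c x y : ℝ≥0∞} (hx : x ≠ ∞)
    (h : x ≤ c * (y ^ (1 / q) * x ^ (1 - 1 / q))) : x ≤ c ^ q * y := by
  have hq0 : 0 < q := by linarith
  rcases eq_or_ne x 0 with rfl | hx0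
  · simp
  have hxx : x ^ (1 / q) * x ^ (1 - 1 / q) = x := by
    rw [← ENNReal.rpow_add _ _ hx0 hx]; simp
  have hne0 : x ^ (1 - 1 / q) ≠ 0 := by simp [ENNReal.rpow_eq_zero_iff, hx0, hx]
  have hnet : x ^ (1 - 1 / q) ≠ ∞ := by simp [ENNReal.rpow_eq_top_iff, hx0, hx]
  have h1 : x ^ (1 / q) ≤ c * y ^ (1 / q) := by
    rw [← ENNReal.mul_le_mul_iff_left hne0 hnet, hxx, mul_assoc]
    exact h
  calc x = (x ^ (1 / q)) ^ q := by rw [← ENNReal.rpow_mul]; field_simp; simp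
    _ ≤ (c * y ^ (1 / q)) ^ q := by gcongr
    _ = c ^ q * y := by
        rw [ENNReal.mul_rpow_of_nonneg _ _ hq0.le, ← ENNReal.rpow_mul (y)]; field_simp; simp

theorem lintegral_familyMax_rpow_ne_top {ν : Measure X} {𝒟 : Finset (Set X)}
    (hm : ∀ Q ∈ 𝒟, MeasurableSet Q) (hfin : ∀ Q ∈ 𝒟, ν Q ≠ ∞) {q : ℝ} (hq : 0 < q)
    {h : X → ℝ≥0∞} (havg : ∀ Q ∈ 𝒟, ⨍⁻ y in Q, h y ∂ν ≠ ∞) :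
    ∫⁻ x, familyMax ν 𝒟 h x ^ q ∂ν ≠ ∞ := by
  have hle : ∀ x, familyMax ν 𝒟 h x ^ q ≤
      ∑ Q ∈ 𝒟, Q.indicator (fun _ => (⨍⁻ y in Q, h y ∂ν) ^ q) x := by
    intro x
    rw [← ENNReal.le_rpow_inv_iff hq]
    refine iSup₂_le fun Q hQ => ?_
    rw [ENNReal.le_rpow_inv_iff hq]
    by_cases hx : x ∈ Q
    · refine le_trans (le_of_eq ?_)
        (Finset.single_le_sum (f := fun Q : Set X => Q.indicator (fun _ =>
          (⨍⁻ y in Q, h y ∂ν) ^ q) x) (fun _ _ => zero_le) hQ)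
      simp [hx]
    · simp [hx, hq]
  refine ne_top_of_le_ne_top ?_ (lintegral_mono hle)
  rw [lintegral_finsetSum _ fun Q hQ => measurable_const.indicator (hm Q hQ)]
  refine ENNReal.sum_ne_top.2 fun Q hQ => ?_
  rw [lintegral_indicator_const (hm Q hQ)]
  exact ENNReal.mul_ne_top (ENNReal.rpow_ne_top_of_nonneg hq.le (havg Q hQ)) (hfin Q hQ)

/-- The `L^q` maximal inequality for a finite laminar family. -/
theorem lintegral_familyMax_rpow_le {ν : Measure X} {𝒟 : Finset (Set X)}
    (hlam : IsLaminar (𝒟 : Set (Set X))) (hm : ∀ Q ∈ 𝒟, MeasurableSet Q)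
    (hpos : ∀ Q ∈ 𝒟, ν Q ≠ 0) (hfin : ∀ Q ∈ 𝒟, ν Q ≠ ∞) {q : ℝ} (hq : 1 < q)
    {h : X → ℝ≥0∞} (hh : Measurable h) :
    ∫⁻ x, familyMax ν 𝒟 h x ^ q ∂ν ≤ ENNReal.ofReal (q / (q - 1)) ^ q * ∫⁻ x, h x ^ q ∂ν := by
  have hq0 : 0 < q := by linarith
  have hq1 : 0 < q - 1 := by linarith
  have hqq : 0 < q / (q - 1) := by positivity
  by_cases hint : ∫⁻ x, h x ^ q ∂ν = ∞
  · rw [hint, ENNReal.mul_top]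
    · exact le_top
    · simp [ENNReal.rpow_eq_zero_iff, hq0, hq0.not_gt, hqq]
  have havg : ∀ Q ∈ 𝒟, ⨍⁻ y in Q, h y ∂ν ≠ ∞ := fun Q hQ => by
    rw [setLAverage_eq]
    exact ENNReal.div_ne_top (setLIntegral_ne_top_of_rpow hq.le hint (hfin Q hQ)) (hpos Q hQ)
  set M := familyMax ν 𝒟 h with hM
  have hMm : Measurable M := measurable_familyMax hm h
  have hMtop : ∀ x, M x ≠ ∞ := by
    intro x
    refine ne_top_of_le_ne_top (ENNReal.sum_ne_top.2 havg) (iSup₂_le fun Q hQ => ?_)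
    refine (indicator_le_self' (fun _ _ => zero_le) x).trans ?_
    exact Finset.single_le_sum (f := fun Q => ⨍⁻ y in Q, h y ∂ν) (fun _ _ => zero_le) hQ
  have hX := lintegral_familyMax_rpow_ne_top hm hfin hq0 havg
  refine le_mul_of_le_mul_rpow_mul_rpow hq hX ?_
  have hconv : ∀ r : ℝ, 0 < r → ∀ x, M x ^ r = ENNReal.ofReal ((M x).toReal ^ r) := by
    intro r hr x
    rw [ENNReal.toReal_rpow, ENNReal.ofReal_toReal]
    exact ENNReal.rpow_ne_top_of_nonneg hr.le (hMtop x)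
  have hlevel : ∀ t : ℝ, 0 < t → {x | t < (M x).toReal} = {x | ENNReal.ofReal t < M x} := by
    intro t ht
    ext x
    simp only [mem_ofPred_eq]
    rw [ENNReal.ofReal_lt_iff_lt_toReal ht.le (hMtop x)]
  -- Layer cake on both sides, with the weak type bound at every level `t`; the factor `q / (q - 1)`
  -- is the ratio of the two layer cake constants. Hölder then gives the hypothesis of the
  -- absorption lemma.
  have hcake : ∫⁻ x, M x ^ q ∂ν ≤
      ENNReal.ofReal (q / (q - 1)) * ∫⁻ x, M x ^ (q - 1) ∂(ν.withDensity h) := by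
    simp_rw [hconv q hq0, hconv (q - 1) hq1]
    rw [lintegral_rpow_eq_lintegral_meas_lt_mul _ (ae_of_all _ fun x => ENNReal.toReal_nonneg)
        hMm.ennreal_toReal.aemeasurable hq0,
      lintegral_rpow_eq_lintegral_meas_lt_mul _ (ae_of_all _ fun x => ENNReal.toReal_nonneg)
        hMm.ennreal_toReal.aemeasurable hq1, ← mul_assoc, ← ENNReal.ofReal_mul hqq.le,
      div_mul_cancel₀ _ hq1.ne']
    gcongr ENNReal.ofReal q * ?_
    refine setLIntegral_mono' measurableSet_Ioi fun t ht => ?_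
    have ht : 0 < t := ht
    have hlev : MeasurableSet {x | ENNReal.ofReal t < M x} := measurableSet_lt measurable_const hMm
    rw [hlevel t ht, withDensity_apply _ hlev]
    have hsplit : ENNReal.ofReal (t ^ (q - 1)) =
        ENNReal.ofReal t * ENNReal.ofReal (t ^ (q - 1 - 1)) := by
      rw [← ENNReal.ofReal_mul ht.le, Real.rpow_sub_one ht.ne' (q - 1)]
      congr 1
      field_simp
    rw [hsplit, ← mul_assoc, mul_comm (ν _)]
    gcongr
    exact mul_measure_lt_familyMax_le hlam hm h _
  refine hcake.trans ?_
  gcongr ENNReal.ofReal (q / (q - 1)) * ?_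
  rw [lintegral_withDensity_eq_lintegral_mul _ hh (hMm.pow_const _)]
  have hconj : q.HolderConjugate (q.conjExponent) := Real.HolderConjugate.conjExponent hq
  refine (ENNReal.lintegral_mul_le_Lp_mul_Lq ν hconj hh.aemeasurable
    (hMm.pow_const _).aemeasurable).trans_eq ?_
  have he : 1 / q.conjExponent = 1 - 1 / q := by
    rw [Real.conjExponent]; field_simp
  rw [he]
  congr 3
  ext x
  rw [← ENNReal.rpow_mul]
  congr 1
  rw [Real.conjExponent]; field_simp

end LaminarFamilies

end MultiWeight

namespace MultiWeight

open MeasureTheory Set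
open scoped ENNReal

/-! ### Sparse selection by generations of the product of averages. -/

section SparseFamilies

/-- Hölder's inequality for finite sums, read off from the integral version with counting measure.
-/
theorem sum_prod_rpow_le {α ι : Type*} (s : Finset α) (t : Finset ι) (f : ι → α → ℝ≥0∞)
    {r : ι → ℝ} (hr : ∑ i ∈ t, r i = 1) (hr0 : ∀ i ∈ t, 0 ≤ r i) :
    ∑ a ∈ s, ∏ i ∈ t, f i a ^ r i ≤ ∏ i ∈ t, (∑ a ∈ s, f i a) ^ r i := by
  let _ : MeasurableSpace α := ⊤
  have h := ENNReal.lintegral_prod_norm_pow_le (μ := Measure.count.restrict (s : Set α)) t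
    (f := f) (fun i _ => (measurable_from_top).aemeasurable) hr hr0
  simpa [lintegral_finset, Measure.count_singleton] using h

variable {X : Type*} [MeasurableSpace X]

/-- The `m`-th root splits `μ Q` evenly among the `m` averages, leaving a product of powers of
integrals with exponents of sum one, as Hölder over disjoint sets requires. -/
theorem prod_setLAverage_rpow_mul {μ : Measure X} {m : ℕ} (hm0 : m ≠ 0) (g : Fin m → X → ℝ≥0∞)
    {Q : Set X} (hpos : μ Q ≠ 0) (hfin : μ Q ≠ ∞) :
    (∏ i, ⨍⁻ y in Q, g i y ∂μ) ^ (1 / (m : ℝ)) * μ Q =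
      ∏ i, (∫⁻ y in Q, g i y ∂μ) ^ (1 / (m : ℝ)) := by
  have hm' : (m : ℝ) ≠ 0 := by exact_mod_cast hm0
  have h0 : (0 : ℝ) ≤ 1 / m := by positivity
  have hμ : μ Q = ∏ _i : Fin m, μ Q ^ (1 / (m : ℝ)) := by
    rw [Finset.prod_const, Finset.card_univ, Fintype.card_fin, ← ENNReal.rpow_mul_natCast]
    field_simp
    simp
  rw [← ENNReal.prod_rpow_of_nonneg h0]
  conv_lhs => rw [hμ]
  rw [← Finset.prod_mul_distrib]
  refine Finset.prod_congr rfl fun i _ => ?_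
  rw [← ENNReal.mul_rpow_of_nonneg _ _ h0, setLAverage_eq, ENNReal.div_mul_cancel hpos hfin]

/-- Subsets of `Q` on which the product of averages exceeds its value on `Q` by the factor `2 ^ m`
cover at most half of `Q`. -/
theorem two_mul_measure_biUnion_le {μ : Measure X} {𝒟 : Finset (Set X)}
    (hlam : IsLaminar (𝒟 : Set (Set X))) (hm : ∀ Q ∈ 𝒟, MeasurableSet Q)
    (hpos : ∀ Q ∈ 𝒟, μ Q ≠ 0) (hfin : ∀ Q ∈ 𝒟, μ Q ≠ ∞) {m : ℕ} (hm0 : m ≠ 0)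
    {g : Fin m → X → ℝ≥0∞} {Q : Set X} (hQ0 : μ Q ≠ 0) (hQ : μ Q ≠ ∞)
    (hT0 : ∏ i, ⨍⁻ y in Q, g i y ∂μ ≠ 0) (hT : ∏ i, ⨍⁻ y in Q, g i y ∂μ ≠ ∞)
    (hsub : ∀ R ∈ 𝒟, R ⊆ Q)
    (hbig : ∀ R ∈ 𝒟, 2 ^ m * ∏ i, ⨍⁻ y in Q, g i y ∂μ ≤ ∏ i, ⨍⁻ y in R, g i y ∂μ) :
    2 * μ (⋃ R ∈ 𝒟, R) ≤ μ Q := by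
  obtain ⟨ℱ, hF, hdisj, hcov⟩ := hlam.exists_disjoint_subfamily
  have hm' : (m : ℝ) ≠ 0 := by exact_mod_cast hm0
  have h0 : (0 : ℝ) ≤ 1 / m := by positivity
  set T := ∏ i, ⨍⁻ y in Q, g i y ∂μ with hTdef
  have hT0' : T ^ (1 / (m : ℝ)) ≠ 0 := by
    rw [Ne, ENNReal.rpow_eq_zero_iff]; simp [hT0, hT]
  have hT' : T ^ (1 / (m : ℝ)) ≠ ∞ := ENNReal.rpow_ne_top_of_nonneg h0 hT
  rw [← ENNReal.mul_le_mul_iff_right hT0' hT']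
  have hone : ∀ R ∈ ℱ, T ^ (1 / (m : ℝ)) * (2 * μ R) ≤
      ∏ i, (∫⁻ y in R, g i y ∂μ) ^ (1 / (m : ℝ)) := by
    intro R hR
    rw [← prod_setLAverage_rpow_mul hm0 g (hpos R (hF hR)) (hfin R (hF hR))]
    -- This is the source of the threshold `2 ^ m`: its `m`-th root is the factor `2` that makes the
    -- large subsets fill at most half of `Q`.
    have h2 : (2 : ℝ≥0∞) = ((2 : ℝ≥0∞) ^ m) ^ (1 / (m : ℝ)) := by
      rw [← ENNReal.rpow_natCast, ← ENNReal.rpow_mul]; field_simp; simp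
    calc T ^ (1 / (m : ℝ)) * (2 * μ R) = (2 * T ^ (1 / (m : ℝ))) * μ R := by ring
      _ = (2 ^ m * T) ^ (1 / (m : ℝ)) * μ R := by
        rw [ENNReal.mul_rpow_of_nonneg _ _ h0, ← h2]
      _ ≤ _ := by
        gcongr
        exact hbig R (hF hR)
  calc T ^ (1 / (m : ℝ)) * (2 * μ (⋃ R ∈ 𝒟, R))
      ≤ T ^ (1 / (m : ℝ)) * (2 * μ (⋃ R ∈ ℱ, R)) := by
        gcongr _ * (_ * μ ?_)
        refine iUnion₂_subset fun R hR => ?_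
        obtain ⟨R', hR', hRR'⟩ := hcov R hR
        exact hRR'.trans (subset_biUnion_of_mem (u := fun R : Set X => R) hR')
    _ ≤ T ^ (1 / (m : ℝ)) * (2 * ∑ R ∈ ℱ, μ R) := by
        gcongr; exact measure_biUnion_finset_le _ _
    _ = ∑ R ∈ ℱ, T ^ (1 / (m : ℝ)) * (2 * μ R) := by rw [Finset.mul_sum, Finset.mul_sum]
    _ ≤ ∑ R ∈ ℱ, ∏ i, (∫⁻ y in R, g i y ∂μ) ^ (1 / (m : ℝ)) := Finset.sum_le_sum hone
    _ ≤ ∏ i, (∑ R ∈ ℱ, ∫⁻ y in R, g i y ∂μ) ^ (1 / (m : ℝ)) :=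
        sum_prod_rpow_le _ _ (fun i R => ∫⁻ y in R, g i y ∂μ) (by simp; field_simp)
          fun _ _ => h0
    _ ≤ ∏ i, (∫⁻ y in Q, g i y ∂μ) ^ (1 / (m : ℝ)) := by
        refine Finset.prod_le_prod' fun i _ => ?_
        gcongr
        refine (lintegral_biUnion_finset hdisj (fun R hR => hm R (hF hR)) (g i)).ge.trans ?_
        exact lintegral_mono_set (iUnion₂_subset fun R hR => hsub R (hF hR))
    _ = T ^ (1 / (m : ℝ)) * μ Q := (prod_setLAverage_rpow_mul hm0 g hQ0 hQ).symm

/-- Members are graded by the integer `k` with `a ^ k ≤ T Q < a ^ (k + 1)`, `a = 2 ^ m`, and `S`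
keeps those whose level exceeds that of every strictly larger member. Removing from `Q` the smaller
members at least two levels higher leaves `E Q` with at least half the measure. The sets `E Q`, `Q ∈
S`, overlap at most twice. The constant `4` is the product of these two losses. -/
theorem exists_sparse_subfamily_of_ne_zero {μ : Measure X} {𝒟 : Finset (Set X)}
    (hlam : IsLaminar (𝒟 : Set (Set X))) (hm : ∀ Q ∈ 𝒟, MeasurableSet Q)
    (hpos : ∀ Q ∈ 𝒟, μ Q ≠ 0) (hfin : ∀ Q ∈ 𝒟, μ Q ≠ ∞) {m : ℕ} (hm0 : m ≠ 0)
    {g : Fin m → X → ℝ≥0∞}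
    (hT0 : ∀ Q ∈ 𝒟, ∏ i, ⨍⁻ y in Q, g i y ∂μ ≠ 0)
    (hT : ∀ Q ∈ 𝒟, ∏ i, ⨍⁻ y in Q, g i y ∂μ ≠ ∞) :
    ∃ S ⊆ 𝒟, (∀ R ∈ 𝒟, ∃ Q ∈ S, R ⊆ Q ∧
        ∏ i, ⨍⁻ y in R, g i y ∂μ ≤ 2 ^ m * ∏ i, ⨍⁻ y in Q, g i y ∂μ) ∧
      ∀ c : Set X → ℝ≥0∞,
        ∑ Q ∈ S, c Q * μ Q ≤ 4 * ∫⁻ x, ⨆ Q ∈ 𝒟, Q.indicator (fun _ => c Q) x ∂μ := by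
  classical
  set T : Set X → ℝ≥0∞ := fun Q => ∏ i, ⨍⁻ y in Q, g i y ∂μ with hTdef
  set a : ℝ≥0∞ := 2 ^ m with ha
  have ha1 : 1 < a := one_lt_pow₀ (by norm_num) hm0
  have hatop : a ≠ ∞ := ENNReal.pow_ne_top (by norm_num)
  have ha0 : a ≠ 0 := (zero_lt_one.trans ha1).ne'
  have hlevel : ∀ Q : Set X, ∃ k : ℤ, Q ∈ 𝒟 → a ^ k ≤ T Q ∧ T Q < a ^ (k + 1) := by
    intro Q
    by_cases hQ : Q ∈ 𝒟
    · obtain ⟨k, hk⟩ := ENNReal.exists_mem_Ico_zpow (hT0 Q hQ) (hT Q hQ) ha1 hatop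
      exact ⟨k, fun _ => hk⟩
    · exact ⟨0, fun h => absurd h hQ⟩
  choose k hk using hlevel
  have hnext : ∀ j : ℤ, a ^ (j + 1) = a * a ^ j := fun j => by
    rw [ENNReal.zpow_add ha0 hatop, zpow_one, mul_comm]
  have hstep : ∀ Q ∈ 𝒟, ∀ R ∈ 𝒟, k Q + 2 ≤ k R → a * T Q ≤ T R := by
    intro Q hQ R hR hQR
    calc a * T Q ≤ a * a ^ (k Q + 1) := by gcongr; exact (hk Q hQ).2.le
      _ = a ^ (k Q + 2) := by rw [← hnext]; ring_nf
      _ ≤ a ^ k R := ENNReal.zpow_le_of_le ha1.le hQR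
      _ ≤ T R := (hk R hR).1
  set S := 𝒟.filter (fun Q => ∀ R ∈ 𝒟, Q ⊂ R → k R < k Q) with hS
  have hSmem : ∀ {Q}, Q ∈ S ↔ Q ∈ 𝒟 ∧ ∀ R ∈ 𝒟, Q ⊂ R → k R < k Q := by
    intro Q; simp [hS]
  set 𝒢 : Set X → Finset (Set X) := fun Q => 𝒟.filter (fun R => R ⊂ Q ∧ k Q + 2 ≤ k R) with h𝒢
  set E : Set X → Set X := fun Q => Q \ ⋃ R ∈ 𝒢 Q, R with hE
  have hEm : ∀ Q ∈ 𝒟, MeasurableSet (E Q) := fun Q hQ =>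
    (hm Q hQ).diff (Finset.measurableSet_biUnion _ fun R hR => hm R (Finset.mem_filter.1 hR).1)
  have hEμ : ∀ Q ∈ 𝒟, μ Q ≤ 2 * μ (E Q) := by
    intro Q hQ
    have hsub : 𝒢 Q ⊆ 𝒟 := Finset.filter_subset _ _
    have h2 : 2 * μ (⋃ R ∈ 𝒢 Q, R) ≤ μ Q := by
      refine two_mul_measure_biUnion_le (hlam.mono (by exact_mod_cast hsub))
        (fun R hR => hm R (hsub hR)) (fun R hR => hpos R (hsub hR))
        (fun R hR => hfin R (hsub hR)) hm0 (hpos Q hQ) (hfin Q hQ) (hT0 Q hQ) (hT Q hQ)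
        (fun R hR => (Finset.mem_filter.1 hR).2.1.subset)
        (fun R hR => hstep Q hQ R (hsub hR) (Finset.mem_filter.1 hR).2.2)
    have h3 : μ Q ≤ μ (E Q) + μ (⋃ R ∈ 𝒢 Q, R) := by
      rw [← measure_sdiff_add_inter (μ := μ) Q
        (Finset.measurableSet_biUnion (𝒢 Q) fun R hR => hm R (hsub hR))]
      gcongr
      exact inter_subset_right
    have h4 : μ Q + μ Q ≤ μ Q + 2 * μ (E Q) := by
      calc μ Q + μ Q = 2 * μ Q := (two_mul _).symm
        _ ≤ 2 * (μ (E Q) + μ (⋃ R ∈ 𝒢 Q, R)) := by gcongr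
        _ = 2 * μ (⋃ R ∈ 𝒢 Q, R) + 2 * μ (E Q) := by ring
        _ ≤ _ := by gcongr
    exact (ENNReal.add_le_add_iff_left (hfin Q hQ)).1 h4
  refine ⟨S, Finset.filter_subset _ _, ?_, ?_⟩
  · intro R hR
    -- A maximal member containing `R` with level at least that of `R` belongs to `S`, since any
    -- larger member of at least its level would contradict maximality.
    obtain ⟨Q, hRQ, hQ⟩ := (𝒟.filter fun Q => R ⊆ Q ∧ k R ≤ k Q).exists_le_maximal
      (a := R) (by simp [hR])
    have hQ' := Finset.mem_filter.1 hQ.prop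
    refine ⟨Q, hSmem.2 ⟨hQ'.1, fun Q' hQ'' hlt => ?_⟩, hRQ, ?_⟩
    · by_contra! hcon
      exact hlt.not_subset (hQ.le_of_ge
        (Finset.mem_filter.2 ⟨hQ'', hRQ.trans hlt.subset, hQ'.2.2.trans hcon⟩) hlt.subset)
    · calc T R ≤ a ^ (k R + 1) := (hk R hR).2.le
        _ = a * a ^ k R := hnext _
        _ ≤ a * a ^ k Q := by gcongr 1; exact ENNReal.zpow_le_of_le ha1.le hQ'.2.2
        _ ≤ a * T Q := by gcongr; exact (hk Q hQ'.1).1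
  · intro c
    have hdiff : ∀ x, ∀ Q ∈ S, ∀ R ∈ S, x ∈ E Q → x ∈ E R → Q ≠ R →
        k R = k Q + 1 ∨ k Q = k R + 1 := by
      have key : ∀ x, ∀ Q ∈ S, ∀ R ∈ S, x ∈ E Q → x ∈ R → R ⊂ Q → k R = k Q + 1 := by
        intro x Q hQ R hR hxQ hxR hlt
        have h1 := (hSmem.1 hR).2 Q (hSmem.1 hQ).1 hlt
        have h2 : ¬ k Q + 2 ≤ k R := fun h2 => hxQ.2 (mem_biUnion
          (Finset.mem_coe.2 (Finset.mem_filter.2 ⟨(hSmem.1 hR).1, hlt, h2⟩)) hxR)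
        omega
      intro x Q hQ R hR hxQ hxR hne
      rcases hlam Q (hSmem.1 hQ).1 R (hSmem.1 hR).1 with h | h | h
      · exact Or.inr (key x R hR Q hQ hxR hxQ.1 (h.ssubset_of_ne hne))
      · exact Or.inl (key x Q hQ R hR hxQ hxR.1 (h.ssubset_of_ne hne.symm))
      · exact absurd hxR.1 (disjoint_left.1 h hxQ.1)
    -- Members of `S` whose `E` sets share a point have levels differing by exactly one, and three
    -- integers cannot pairwise differ by one.
    have hcard : ∀ x, (S.filter fun Q => x ∈ E Q).card ≤ 2 := by
      intro x
      by_contra! hcon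
      obtain ⟨Q₁, Q₂, Q₃, h₁, h₂, h₃, h₁₂, h₁₃, h₂₃⟩ := Finset.two_lt_card_iff.1 hcon
      rw [Finset.mem_filter] at h₁ h₂ h₃
      have e₁ := hdiff x _ h₁.1 _ h₂.1 h₁.2 h₂.2 h₁₂
      have e₂ := hdiff x _ h₁.1 _ h₃.1 h₁.2 h₃.2 h₁₃
      have e₃ := hdiff x _ h₂.1 _ h₃.1 h₂.2 h₃.2 h₂₃
      omega
    have hpt : ∀ x, ∑ Q ∈ S, (E Q).indicator (fun _ => c Q) x ≤
        2 * ⨆ Q ∈ 𝒟, Q.indicator (fun _ => c Q) x := by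
      intro x
      have hfilter : ∑ Q ∈ S, (E Q).indicator (fun _ => c Q) x =
          ∑ Q ∈ S.filter (fun Q => x ∈ E Q), c Q := by
        rw [Finset.sum_filter (s := S)]
        exact Finset.sum_congr rfl fun Q _ => by by_cases hx : x ∈ E Q <;> simp [hx]
      rw [hfilter]
      refine (Finset.sum_le_card_nsmul _ _ (⨆ Q ∈ 𝒟, Q.indicator (fun _ => c Q) x) ?_).trans ?_
      · intro Q hQ
        rw [Finset.mem_filter] at hQ
        exact le_iSup_indicator_const c (hSmem.1 hQ.1).1 hQ.2.1
      · rw [nsmul_eq_mul]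
        gcongr
        exact_mod_cast hcard x
    calc ∑ Q ∈ S, c Q * μ Q ≤ ∑ Q ∈ S, c Q * (2 * μ (E Q)) := by
          refine Finset.sum_le_sum fun Q hQ => ?_
          gcongr
          exact hEμ Q (hSmem.1 hQ).1
      _ = 2 * ∫⁻ x, ∑ Q ∈ S, (E Q).indicator (fun _ => c Q) x ∂μ := by
          rw [lintegral_finsetSum _ fun Q hQ =>
            measurable_const.indicator (hEm Q (hSmem.1 hQ).1), Finset.mul_sum]
          refine Finset.sum_congr rfl fun Q hQ => ?_
          rw [lintegral_indicator_const (hEm Q (hSmem.1 hQ).1)]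
          ring
      _ ≤ 2 * ∫⁻ x, 2 * ⨆ Q ∈ 𝒟, Q.indicator (fun _ => c Q) x ∂μ := by
          gcongr with x; exact hpt x
      _ = _ := by
          rw [lintegral_const_mul _ (measurable_iSup_indicator_const hm c), ← mul_assoc]
          norm_num

/-- The sparse selection principle for the products of averages over a finite laminar family. -/
theorem exists_sparse_subfamily {μ : Measure X} {𝒟 : Finset (Set X)}
    (hlam : IsLaminar (𝒟 : Set (Set X))) (hm : ∀ Q ∈ 𝒟, MeasurableSet Q)
    (hpos : ∀ Q ∈ 𝒟, μ Q ≠ 0) (hfin : ∀ Q ∈ 𝒟, μ Q ≠ ∞) {m : ℕ} (hm0 : m ≠ 0)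
    {g : Fin m → X → ℝ≥0∞} (hT : ∀ Q ∈ 𝒟, ∏ i, ⨍⁻ y in Q, g i y ∂μ ≠ ∞) :
    ∃ S ⊆ 𝒟, (∀ R ∈ 𝒟, ∏ i, ⨍⁻ y in R, g i y ∂μ ≠ 0 → ∃ Q ∈ S, R ⊆ Q ∧
        ∏ i, ⨍⁻ y in R, g i y ∂μ ≤ 2 ^ m * ∏ i, ⨍⁻ y in Q, g i y ∂μ) ∧
      ∀ c : Set X → ℝ≥0∞,
        ∑ Q ∈ S, c Q * μ Q ≤ 4 * ∫⁻ x, ⨆ Q ∈ 𝒟, Q.indicator (fun _ => c Q) x ∂μ := by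
  classical
  -- Members with vanishing product have no integer level and are discarded.
  have hsub : 𝒟.filter (fun Q => ∏ i, ⨍⁻ y in Q, g i y ∂μ ≠ 0) ⊆ 𝒟 := Finset.filter_subset _ _
  obtain ⟨S, hS, hcov, hsum⟩ := exists_sparse_subfamily_of_ne_zero (μ := μ) (g := g)
    (hlam.mono (by exact_mod_cast hsub)) (fun Q hQ => hm Q (hsub hQ))
    (fun Q hQ => hpos Q (hsub hQ)) (fun Q hQ => hfin Q (hsub hQ)) hm0
    (fun Q hQ => (Finset.mem_filter.1 hQ).2) (fun Q hQ => hT Q (hsub hQ))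
  refine ⟨S, hS.trans hsub, fun R hR h0 => hcov R (Finset.mem_filter.2 ⟨hR, h0⟩), fun c => ?_⟩
  refine (hsum c).trans ?_
  gcongr 4 * ?_
  exact lintegral_mono fun x => iSup₂_le fun Q hQ =>
    le_iSup₂ (f := fun Q (_ : Q ∈ 𝒟) => Q.indicator (fun _ => c Q) x) Q (hsub hQ)

end SparseFamilies

end MultiWeight

namespace MultiWeight

open MeasureTheory Set
open scoped ENNReal

/-! ### The strong type inequality over a laminar family. -/

section WeightedFamilies

variable {X : Type*} [MeasurableSpace X]

theorem setLAverage_mul_eq {μ : Measure X} {s F : X → ℝ≥0∞} (hs : Measurable s)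
    (hF : Measurable F) {Q : Set X} (hQ : MeasurableSet Q)
    (h0 : μ.withDensity s Q ≠ 0) (ht : μ.withDensity s Q ≠ ∞) :
    ⨍⁻ y in Q, s y * F y ∂μ = (⨍⁻ y in Q, s y ∂μ) * ⨍⁻ y in Q, F y ∂(μ.withDensity s) := by
  rw [setLAverage_eq, setLAverage_eq, setLAverage_eq, restrict_withDensity hQ,
    lintegral_withDensity_eq_lintegral_mul _ hs hF, withDensity_apply _ hQ]
  rw [withDensity_apply _ hQ] at h0 ht
  simp only [Pi.mul_apply, div_eq_mul_inv]
  calc (∫⁻ y in Q, s y * F y ∂μ) * (μ Q)⁻¹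
      = ((∫⁻ y in Q, s y ∂μ) * (∫⁻ y in Q, s y ∂μ)⁻¹) *
          ((∫⁻ y in Q, s y * F y ∂μ) * (μ Q)⁻¹) := by
        rw [ENNReal.mul_inv_cancel h0 ht, one_mul]
    _ = _ := by ring

theorem setLAverage_const_mul {μ : Measure X} {f : X → ℝ≥0∞} (hf : Measurable f) (c : ℝ≥0∞)
    (Q : Set X) : ⨍⁻ y in Q, c * f y ∂μ = c * ⨍⁻ y in Q, f y ∂μ := by
  rw [setLAverage_eq, setLAverage_eq, lintegral_const_mul _ hf, mul_div_assoc]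

/-- The constant in the strong type inequality for products of averages over a laminar family. -/
noncomputable def laminarConst {m : ℕ} (p : ℝ) (P : Fin m → ℝ) : ℝ≥0∞ :=
  (2 ^ m) ^ p * (4 * ENNReal.ofReal (2 / (2 - 1)) ^ (2 : ℝ) *
    ∏ i, ENNReal.ofReal (P i / (P i - 1)) ^ p)

/-- Hölder with exponents `P i / p`, followed by the maximal inequality in `L^{P i}` of the measure
with density `s i`. -/
theorem lintegral_prod_familyMax_le {μ : Measure X} {𝒟 : Finset (Set X)}
    (hlam : IsLaminar (𝒟 : Set (Set X))) (hm : ∀ Q ∈ 𝒟, MeasurableSet Q)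
    {m : ℕ} {P : Fin m → ℝ} (hP : ∀ i, 1 < P i) {p : ℝ} (hp0 : 0 < p)
    (hsum : ∑ i, p / P i = 1) {s F : Fin m → X → ℝ≥0∞} (hs : ∀ i, Measurable (s i))
    (hF : ∀ i, Measurable (F i))
    (hpos : ∀ i, ∀ Q ∈ 𝒟, μ.withDensity (s i) Q ≠ 0)
    (hfin : ∀ i, ∀ Q ∈ 𝒟, μ.withDensity (s i) Q ≠ ∞) :
    ∫⁻ x, ∏ i, s i x ^ (p / P i) * familyMax (μ.withDensity (s i)) 𝒟 (F i) x ^ p ∂μ ≤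
      (∏ i, ENNReal.ofReal (P i / (P i - 1)) ^ p) *
        ∏ i, (∫⁻ x, F i x ^ P i ∂(μ.withDensity (s i))) ^ (p / P i) := by
  have hP0 : ∀ i, 0 < P i := fun i => zero_lt_one.trans (hP i)
  have hw : ∀ i, 0 ≤ p / P i := fun i => (div_pos hp0 (hP0 i)).le
  have hM : ∀ i, Measurable (familyMax (μ.withDensity (s i)) 𝒟 (F i)) :=
    fun i => measurable_familyMax hm _
  calc ∫⁻ x, ∏ i, s i x ^ (p / P i) * familyMax (μ.withDensity (s i)) 𝒟 (F i) x ^ p ∂μ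
      = ∫⁻ x, ∏ i, (s i x * familyMax (μ.withDensity (s i)) 𝒟 (F i) x ^ P i) ^ (p / P i) ∂μ := by
        congr 1 with x
        refine Finset.prod_congr rfl fun i _ => ?_
        rw [ENNReal.mul_rpow_of_nonneg _ _ (hw i), ← ENNReal.rpow_mul,
          mul_div_cancel₀ _ (hP0 i).ne']
    _ ≤ ∏ i, (∫⁻ x, s i x * familyMax (μ.withDensity (s i)) 𝒟 (F i) x ^ P i ∂μ) ^ (p / P i) :=
        ENNReal.lintegral_prod_norm_pow_le _
          (fun i _ => ((hs i).mul ((hM i).pow_const _)).aemeasurable) hsum fun i _ => hw i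
    _ ≤ ∏ i, (ENNReal.ofReal (P i / (P i - 1)) ^ P i *
          ∫⁻ x, F i x ^ P i ∂(μ.withDensity (s i))) ^ (p / P i) := by
        refine Finset.prod_le_prod' fun i _ => ENNReal.rpow_le_rpow ?_ (hw i)
        refine le_trans (le_of_eq ?_) (lintegral_familyMax_rpow_le hlam hm (hpos i) (hfin i)
          (hP i) (hF i))
        rw [lintegral_withDensity_eq_lintegral_mul _ (hs i) ((hM i).pow_const _)]
        rfl
    _ = _ := by
        rw [← Finset.prod_mul_distrib]
        refine Finset.prod_congr rfl fun i _ => ?_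
        rw [ENNReal.mul_rpow_of_nonneg _ _ (hw i), ← ENNReal.rpow_mul,
          mul_div_cancel₀ _ (hP0 i).ne']

/-- The strong type inequality for products of averages over a finite laminar family, under a
two-weight condition of geometric mean type. -/
theorem lintegral_iSup_prod_setLAverage_rpow_le {μ V : Measure X} {𝒟 : Finset (Set X)}
    (hlam : IsLaminar (𝒟 : Set (Set X))) (hm : ∀ Q ∈ 𝒟, MeasurableSet Q)
    (hμ0 : ∀ Q ∈ 𝒟, μ Q ≠ 0) (hμ : ∀ Q ∈ 𝒟, μ Q ≠ ∞) {m : ℕ} (hm0 : m ≠ 0)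
    {P : Fin m → ℝ} (hP : ∀ i, 1 < P i) {p : ℝ} (hp0 : 0 < p) (hsum : ∑ i, p / P i = 1)
    {s F : Fin m → X → ℝ≥0∞} (hs : ∀ i, Measurable (s i)) (hF : ∀ i, Measurable (F i))
    (hpos : ∀ i, ∀ Q ∈ 𝒟, μ.withDensity (s i) Q ≠ 0)
    (hfin : ∀ i, ∀ Q ∈ 𝒟, μ.withDensity (s i) Q ≠ ∞)
    (hint : ∀ i, ∫⁻ x, F i x ^ P i ∂(μ.withDensity (s i)) ≠ ∞) {B : ℝ≥0∞}
    (hB : ∀ Q ∈ 𝒟, V Q / μ Q * (∏ i, ⨍⁻ y in Q, s i y ∂μ) ^ p ≤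
      B * (⨍⁻ y in Q, (∏ i, s i y ^ (p / P i)) ^ (1 / 2 : ℝ) ∂μ) ^ (2 : ℝ)) :
    ∫⁻ x, ⨆ Q ∈ 𝒟, Q.indicator (fun _ => (∏ i, ⨍⁻ y in Q, s i y * F i y ∂μ) ^ p) x ∂V ≤
      laminarConst p P * B *
        ∏ i, (∫⁻ x, F i x ^ P i ∂(μ.withDensity (s i))) ^ (p / P i) := by
  set N : Fin m → Measure X := fun i => μ.withDensity (s i) with hN
  set M : Fin m → X → ℝ≥0∞ := fun i => familyMax (N i) 𝒟 (F i) with hMdef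
  have hM : ∀ i, Measurable (M i) := fun i => measurable_familyMax hm _
  set T : Set X → ℝ≥0∞ := fun Q => ∏ i, ⨍⁻ y in Q, s i y * F i y ∂μ with hTdef
  set e : Set X → ℝ≥0∞ := fun Q => ∏ i, ⨍⁻ y in Q, F i y ∂(N i) with hedef
  have hTe : ∀ Q ∈ 𝒟, T Q = (∏ i, ⨍⁻ y in Q, s i y ∂μ) * e Q := by
    intro Q hQ
    rw [hTdef, hedef, ← Finset.prod_mul_distrib]
    exact Finset.prod_congr rfl fun i _ =>
      setLAverage_mul_eq (hs i) (hF i) (hm Q hQ) (hpos i Q hQ) (hfin i Q hQ)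
  have hTtop : ∀ Q ∈ 𝒟, T Q ≠ ∞ := by
    intro Q hQ
    refine ENNReal.prod_ne_top fun i _ => ?_
    rw [setLAverage_mul_eq (hs i) (hF i) (hm Q hQ) (hpos i Q hQ) (hfin i Q hQ), setLAverage_eq,
      setLAverage_eq, ← withDensity_apply _ (hm Q hQ)]
    exact ENNReal.mul_ne_top (ENNReal.div_ne_top (hfin i Q hQ) (hμ0 Q hQ))
      (ENNReal.div_ne_top (setLIntegral_ne_top_of_rpow (hP i).le (hint i) (hfin i Q hQ))
        (hpos i Q hQ))
  obtain ⟨S, hS, hcov, hsparse⟩ := exists_sparse_subfamily (g := fun i y => s i y * F i y)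
    hlam hm hμ0 hμ hm0 hTtop
  set h : X → ℝ≥0∞ := fun y => (∏ i, s i y ^ (p / P i)) ^ (1 / 2 : ℝ) with hhdef
  -- The root `1 / 2` is what allows a maximal inequality with exponent `2 > 1` to be applied to
  -- `H`, while `H ^ 2` remains the integrand to which Hölder applies.
  set H : X → ℝ≥0∞ := fun y => (∏ i, s i y ^ (p / P i) * M i y ^ p) ^ (1 / 2 : ℝ) with hHdef
  have hhm : Measurable h :=
    (Finset.measurable_prod _ fun i _ => (hs i).pow_const _).pow_const _
  have hHm : Measurable H := (Finset.measurable_prod _ fun i _ =>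
    ((hs i).pow_const _).mul ((hM i).pow_const _)).pow_const _
  -- The constant `e Q` moves inside the average, where it is dominated pointwise on `Q` by the
  -- product of the weighted maximal functions.
  have hhH : ∀ Q ∈ 𝒟, (e Q ^ p) ^ (1 / 2 : ℝ) * ⨍⁻ y in Q, h y ∂μ ≤ ⨍⁻ y in Q, H y ∂μ := by
    intro Q hQ
    rw [← setLAverage_const_mul hhm, setLAverage_eq, setLAverage_eq]
    refine ENNReal.div_le_div_right (setLIntegral_mono' (hm Q hQ) fun y hy => ?_) _
    rw [hhdef, hHdef]
    simp only
    rw [← ENNReal.mul_rpow_of_nonneg _ _ (by norm_num), Finset.prod_mul_distrib, mul_comm]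
    gcongr
    rw [← ENNReal.prod_rpow_of_nonneg hp0.le]
    refine Finset.prod_le_prod' fun i _ => ?_
    gcongr
    exact setLAverage_le_familyMax _ hQ hy
  have hterm : ∀ Q ∈ 𝒟, T Q ^ p * V Q ≤ B * ((⨍⁻ y in Q, H y ∂μ) ^ (2 : ℝ) * μ Q) := by
    intro Q hQ
    have hsq : (e Q ^ p) = ((e Q ^ p) ^ (1 / 2 : ℝ)) ^ (2 : ℝ) := by
      rw [← ENNReal.rpow_mul (e Q ^ p)]; norm_num
    calc T Q ^ p * V Q
        = (V Q / μ Q * (∏ i, ⨍⁻ y in Q, s i y ∂μ) ^ p) * e Q ^ p * μ Q := by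
          rw [hTe Q hQ, ENNReal.mul_rpow_of_nonneg _ _ hp0.le]
          have hV : V Q = V Q / μ Q * μ Q := (ENNReal.div_mul_cancel (hμ0 Q hQ) (hμ Q hQ)).symm
          conv_lhs => rw [hV]
          ring
      _ ≤ (B * (⨍⁻ y in Q, h y ∂μ) ^ (2 : ℝ)) * e Q ^ p * μ Q := by
          gcongr ?_ * _ * _
          exact hB Q hQ
      _ = B * (((e Q ^ p) ^ (1 / 2 : ℝ) * ⨍⁻ y in Q, h y ∂μ) ^ (2 : ℝ) * μ Q) := by
          rw [ENNReal.mul_rpow_of_nonneg _ _ (by norm_num), ← hsq]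
          ring
      _ ≤ _ := by
          gcongr
          exact hhH Q hQ
  have hdom : ∀ x, ⨆ Q ∈ 𝒟, Q.indicator (fun _ => T Q ^ p) x ≤
      ∑ Q ∈ S, Q.indicator (fun _ => (2 ^ m) ^ p * T Q ^ p) x := by
    intro x
    refine iSup₂_le fun R hR => ?_
    by_cases hx : x ∈ R
    · rw [indicator_of_mem hx]
      rcases eq_or_ne (T R) 0 with h0 | h0
      · simp [h0, hp0]
      obtain ⟨Q, hQ, hRQ, hle⟩ := hcov R hR h0
      refine le_trans ?_ (Finset.single_le_sum (f := fun Q : Set X =>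
        Q.indicator (fun _ => (2 ^ m) ^ p * T Q ^ p) x) (fun _ _ => zero_le) hQ)
      rw [indicator_of_mem (hRQ hx), ← ENNReal.mul_rpow_of_nonneg _ _ hp0.le]
      gcongr
    · simp [hx]
  have hsup : ∀ x, ⨆ Q ∈ 𝒟, Q.indicator (fun _ => (⨍⁻ y in Q, H y ∂μ) ^ (2 : ℝ)) x ≤
      familyMax μ 𝒟 H x ^ (2 : ℝ) := by
    intro x
    refine iSup₂_le fun Q hQ => ?_
    by_cases hx : x ∈ Q
    · rw [indicator_of_mem hx]
      gcongr
      exact setLAverage_le_familyMax _ hQ hx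
    · simp [hx]
  calc ∫⁻ x, ⨆ Q ∈ 𝒟, Q.indicator (fun _ => T Q ^ p) x ∂V
      ≤ ∫⁻ x, ∑ Q ∈ S, Q.indicator (fun _ => (2 ^ m) ^ p * T Q ^ p) x ∂V := lintegral_mono hdom
    _ = (2 ^ m) ^ p * ∑ Q ∈ S, T Q ^ p * V Q := by
        rw [lintegral_finsetSum _ fun Q hQ => measurable_const.indicator (hm Q (hS hQ)),
          Finset.mul_sum]
        refine Finset.sum_congr rfl fun Q hQ => ?_
        rw [lintegral_indicator_const (hm Q (hS hQ)), mul_assoc]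
    _ ≤ (2 ^ m) ^ p * ∑ Q ∈ S, B * ((⨍⁻ y in Q, H y ∂μ) ^ (2 : ℝ) * μ Q) := by
        refine mul_le_mul_right (Finset.sum_le_sum fun Q hQ => ?_) _
        exact hterm Q (hS hQ)
    _ ≤ (2 ^ m) ^ p * (B * (4 * ∫⁻ x, familyMax μ 𝒟 H x ^ (2 : ℝ) ∂μ)) := by
        rw [← Finset.mul_sum]
        gcongr
        refine (hsparse fun Q => (⨍⁻ y in Q, H y ∂μ) ^ (2 : ℝ)).trans ?_
        gcongr with x
        exact hsup x
    _ ≤ (2 ^ m) ^ p * (B * (4 * (ENNReal.ofReal (2 / (2 - 1)) ^ (2 : ℝ) *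
          ∫⁻ x, H x ^ (2 : ℝ) ∂μ))) := by
        gcongr
        exact lintegral_familyMax_rpow_le hlam hm hμ0 hμ one_lt_two hHm
    _ ≤ (2 ^ m) ^ p * (B * (4 * (ENNReal.ofReal (2 / (2 - 1)) ^ (2 : ℝ) *
          ((∏ i, ENNReal.ofReal (P i / (P i - 1)) ^ p) *
            ∏ i, (∫⁻ x, F i x ^ P i ∂(N i)) ^ (p / P i))))) := by
        gcongr
        refine le_trans (le_of_eq ?_)
          (lintegral_prod_familyMax_le hlam hm hP hp0 hsum hs hF hpos hfin)
        congr 1 with x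
        rw [hHdef]
        simp only
        rw [← ENNReal.rpow_mul]
        norm_num
        rfl
    _ = _ := by rw [laminarConst]; ring

end WeightedFamilies

end MultiWeight

namespace MultiWeight

open MeasureTheory Set
open scoped ENNReal

/-! ### Translated dyadic grids and the one-third trick. -/

section DyadicGrids

variable {n : ℕ}

/-- The half-open cube with index `k` and side length `2 ^ j` in the dyadic grid translated
by `τ`. -/
def gridCube (τ : Fin n → ℝ) (j : ℤ) (k : Fin n → ℤ) : Set (Fin n → ℝ) :=
  Set.univ.pi fun i => Ico (τ i + 2 ^ j * k i) (τ i + 2 ^ j * k i + 2 ^ j)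

theorem mem_Ico_grid_iff {τ x : ℝ} {j k : ℤ} :
    x ∈ Ico (τ + 2 ^ j * k) (τ + 2 ^ j * k + 2 ^ j) ↔ ⌊(x - τ) / 2 ^ j⌋ = k := by
  have h2 : (0 : ℝ) < 2 ^ j := by positivity
  rw [Int.floor_eq_iff, le_div_iff₀ h2, div_lt_iff₀ h2, mem_Ico]
  constructor <;> rintro ⟨h, h'⟩ <;> constructor <;> linarith

theorem mem_gridCube_iff {τ x : Fin n → ℝ} {j : ℤ} {k : Fin n → ℤ} :
    x ∈ gridCube τ j k ↔ ∀ i, ⌊(x i - τ i) / 2 ^ j⌋ = k i := by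
  simp [gridCube, ← mem_Ico_grid_iff]

/-- The coarse index is determined by the fine one, which is why cubes of one grid are nested across
scales. -/
theorem floor_div_two_zpow (y : ℝ) {j j' : ℤ} (h : j ≤ j') :
    ⌊y / 2 ^ j'⌋ = ⌊y / 2 ^ j⌋ / ((2 ^ (j' - j).toNat : ℕ) : ℤ) := by
  obtain ⟨N, rfl⟩ := Int.le.dest h
  rw [← Int.floor_div_natCast, zpow_add₀ two_ne_zero, ← div_div]
  simp

theorem gridCube_subset {τ x : Fin n → ℝ} {j j' : ℤ} {k k' : Fin n → ℤ} (h : j ≤ j')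
    (hx : x ∈ gridCube τ j k) (hx' : x ∈ gridCube τ j' k') :
    gridCube τ j k ⊆ gridCube τ j' k' := by
  intro y hy
  rw [mem_gridCube_iff] at *
  intro i
  rw [← hx' i, floor_div_two_zpow _ h, floor_div_two_zpow (x i - τ i) h, hx i, hy i]

theorem isLaminar_range_gridCube (τ : Fin n → ℝ) :
    IsLaminar (range fun q : ℤ × (Fin n → ℤ) => gridCube τ q.1 q.2) := by
  rintro _ ⟨q, rfl⟩ _ ⟨r, rfl⟩
  by_cases hd : Disjoint (gridCube τ q.1 q.2) (gridCube τ r.1 r.2)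
  · exact Or.inr (Or.inr hd)
  · obtain ⟨x, hx, hx'⟩ := not_disjoint_iff.1 hd
    rcases le_total q.1 r.1 with h | h
    · exact Or.inl (gridCube_subset h hx hx')
    · exact Or.inr (Or.inl (gridCube_subset h hx' hx))

theorem measurableSet_gridCube (τ : Fin n → ℝ) (j : ℤ) (k : Fin n → ℤ) :
    MeasurableSet (gridCube τ j k) :=
  MeasurableSet.univ_pi fun _ => measurableSet_Ico

theorem gridCube_ae_eq_cube (τ : Fin n → ℝ) (j : ℤ) (k : Fin n → ℤ) :
    gridCube τ j k =ᵐ[volume] cube (fun i => τ i + 2 ^ j * k i) (2 ^ j) :=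
  Measure.univ_pi_Ico_ae_eq_Icc

theorem volume_cube (a : Fin n → ℝ) (ℓ : ℝ) : volume (cube a ℓ) = ENNReal.ofReal ℓ ^ n := by
  simp [cube, Real.volume_Icc_pi]

theorem volume_gridCube (τ : Fin n → ℝ) (j : ℤ) (k : Fin n → ℤ) :
    volume (gridCube τ j k) = ENNReal.ofReal (2 ^ j) ^ n := by
  rw [measure_congr (gridCube_ae_eq_cube τ j k), volume_cube]

/-- The translation vector with coordinates `0` or `2 ^ K / 3`. -/
noncomputable def thirdShift (K : ℕ) (α : Fin n → Bool) (i : Fin n) : ℝ :=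
  if α i then 2 ^ K / 3 else 0

/-- If both grids failed, each would have an endpoint in `(a, a + ℓ]`, at distance less than `2 ^ j
/ 3`. With `N = K - j` this forces the integer `3 (k - k') - 2 ^ N` to vanish, so `3` would divide a
power of `2`. The condition `j ≤ K` makes `2 ^ N` an integer. -/
theorem exists_shifted_interval {j : ℤ} {K : ℕ} (hjK : j ≤ K) {ℓ : ℝ} (hℓ : 3 * ℓ ≤ 2 ^ j)
    (a : ℝ) : ∃ (b : Bool) (k : ℤ), Icc a (a + ℓ) ⊆
      Ico ((if b then 2 ^ K / 3 else 0) + 2 ^ j * (k : ℝ))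
        ((if b then 2 ^ K / 3 else 0) + 2 ^ j * (k : ℝ) + 2 ^ j) := by
  by_contra! hcon
  have key : ∀ b : Bool, ∃ k : ℤ, a < (if b then 2 ^ K / 3 else 0) + 2 ^ j * (k : ℝ) ∧
      (if b then 2 ^ K / 3 else 0) + 2 ^ j * (k : ℝ) ≤ a + ℓ := by
    intro b
    set t : ℝ := if b then 2 ^ K / 3 else 0 with ht
    have hmem : a ∈ Ico _ _ := mem_Ico_grid_iff (τ := t) (j := j).2 rfl
    refine ⟨⌊(a - t) / 2 ^ j⌋ + 1, by push_cast; linarith [hmem.2], ?_⟩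
    by_contra! hlt
    push_cast at hlt
    exact hcon b _ fun x hx => ⟨hmem.1.trans hx.1, by linarith [hx.2]⟩
  obtain ⟨k, hk, hk'⟩ := key false
  obtain ⟨k', hk₁, hk₁'⟩ := key true
  simp only [Bool.false_eq_true, if_false, if_true] at hk hk' hk₁ hk₁'
  obtain ⟨N, hN⟩ := Int.le.dest hjK
  have hpow : (2 : ℝ) ^ K = 2 ^ j * 2 ^ N := by
    rw [← zpow_natCast (2 : ℝ) K, ← zpow_natCast (2 : ℝ) N, ← zpow_add₀ two_ne_zero, hN]
  have h2 : (0 : ℝ) < 2 ^ j := by positivity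
  rw [hpow] at hk₁ hk₁'
  have h1 : (3 * (k - k') - 2 ^ N : ℝ) < 1 := by
    refine lt_of_mul_lt_mul_left (a := (2 : ℝ) ^ j) ?_ h2.le
    linarith
  have h3 : (-1 : ℝ) < 3 * (k - k') - 2 ^ N := by
    refine lt_of_mul_lt_mul_left (a := (2 : ℝ) ^ j) ?_ h2.le
    linarith
  have h4 : 3 * (k - k') - 2 ^ N < 1 := by exact_mod_cast h1
  have h5 : -1 < 3 * (k - k') - 2 ^ N := by exact_mod_cast h3
  have h6 : (3 : ℤ) ∣ 2 ^ N := ⟨k - k', by omega⟩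
  have h7 := Int.prime_three.dvd_of_dvd_pow h6
  norm_num at h7

theorem exists_cube_subset_gridCube {j : ℤ} {K : ℕ} (hjK : j ≤ K) {ℓ : ℝ} (hℓ : 3 * ℓ ≤ 2 ^ j)
    (a : Fin n → ℝ) : ∃ (α : Fin n → Bool) (k : Fin n → ℤ),
      cube a ℓ ⊆ gridCube (thirdShift K α) j k := by
  choose α k h using fun i => exists_shifted_interval hjK hℓ (a i)
  refine ⟨α, k, fun x hx i _ => h i ⟨hx.1 i, hx.2 i⟩⟩

theorem exists_zpow_two_side {ℓ : ℝ} (hℓ : 0 < ℓ) : ∃ j : ℤ, 3 * ℓ ≤ 2 ^ j ∧ (2 : ℝ) ^ j ≤ 6 * ℓ := by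
  obtain ⟨j, h, h'⟩ := exists_mem_Ico_zpow (x := 3 * ℓ) (y := (2 : ℝ)) (by positivity) one_lt_two
  rw [zpow_add_one₀ two_ne_zero] at h'
  exact ⟨j + 1, by rw [zpow_add_one₀ two_ne_zero]; linarith,
    by rw [zpow_add_one₀ two_ne_zero]; linarith⟩

/-- The average over a cube is controlled by the average over a larger grid cube of comparable
side length. -/
theorem lintegral_cube_div_le {g : (Fin n → ℝ) → ℝ≥0∞} {a : Fin n → ℝ} {ℓ : ℝ} (hℓ : 0 < ℓ)
    {τ : Fin n → ℝ} {j : ℤ} {k : Fin n → ℤ} (hj : (2 : ℝ) ^ j ≤ 6 * ℓ)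
    (hsub : cube a ℓ ⊆ gridCube τ j k) :
    (∫⁻ y in cube a ℓ, g y) / volume (cube a ℓ) ≤
      6 ^ n * ⨍⁻ y in gridCube τ j k, g y ∂volume := by
  have h2 : (0 : ℝ) < 2 ^ j := by positivity
  have hvol : volume (gridCube τ j k) ≤ 6 ^ n * volume (cube a ℓ) := by
    rw [volume_gridCube, volume_cube, ← mul_pow]
    gcongr
    rw [← ENNReal.ofReal_ofNat 6, ← ENNReal.ofReal_mul (by norm_num)]
    exact ENNReal.ofReal_le_ofReal hj
  have h0 : volume (cube a ℓ) ≠ 0 := by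
    rw [volume_cube]; exact pow_ne_zero _ (by simpa using hℓ)
  have ht : volume (cube a ℓ) ≠ ∞ := by
    rw [volume_cube]; exact ENNReal.pow_ne_top ENNReal.ofReal_ne_top
  have h0' : volume (gridCube τ j k) ≠ 0 := by
    rw [volume_gridCube]; exact pow_ne_zero _ (by simpa using h2)
  have ht' : volume (gridCube τ j k) ≠ ∞ := by
    rw [volume_gridCube]; exact ENNReal.pow_ne_top ENNReal.ofReal_ne_top
  rw [setLAverage_eq, ENNReal.div_le_iff h0 ht]
  calc ∫⁻ y in cube a ℓ, g y ≤ ∫⁻ y in gridCube τ j k, g y := lintegral_mono_set hsub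
    _ = (∫⁻ y in gridCube τ j k, g y) / volume (gridCube τ j k) * volume (gridCube τ j k) :=
        (ENNReal.div_mul_cancel h0' ht').symm
    _ ≤ (∫⁻ y in gridCube τ j k, g y) / volume (gridCube τ j k) *
          (6 ^ n * volume (cube a ℓ)) := by gcongr
    _ = _ := by ring

end DyadicGrids

end MultiWeight

namespace MultiWeight

open MeasureTheory Set
open scoped ENNReal

/-! ### From grid maximal functions to the full maximal function. -/

section GridMaximal

variable {n m : ℕ}

/-- The `p`-th power of the maximal function over the cubes of the dyadic grid translated
by `τ`. -/
noncomputable def gridMax (τ : Fin n → ℝ) (p : ℝ) (g : Fin m → (Fin n → ℝ) → ℝ≥0∞)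
    (x : Fin n → ℝ) : ℝ≥0∞ :=
  ⨆ q : ℤ × (Fin n → ℤ), (gridCube τ q.1 q.2).indicator
    (fun _ => (∏ i, ⨍⁻ y in gridCube τ q.1 q.2, g i y ∂volume) ^ p) x

theorem measurable_gridMax (τ : Fin n → ℝ) (p : ℝ) (g : Fin m → (Fin n → ℝ) → ℝ≥0∞) :
    Measurable (gridMax τ p g) :=
  Measurable.iSup fun q => measurable_const.indicator (measurableSet_gridCube τ q.1 q.2)

theorem lintegral_gridMax_le {V : Measure (Fin n → ℝ)} {τ : Fin n → ℝ} {p : ℝ}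
    {g : Fin m → (Fin n → ℝ) → ℝ≥0∞} {A : ℝ≥0∞}
    (h : ∀ 𝒟 : Finset (Set (Fin n → ℝ)),
      (𝒟 : Set (Set (Fin n → ℝ))) ⊆ range (fun q : ℤ × (Fin n → ℤ) => gridCube τ q.1 q.2) →
      ∫⁻ x, ⨆ Q ∈ 𝒟, Q.indicator (fun _ => (∏ i, ⨍⁻ y in Q, g i y ∂volume) ^ p) x ∂V ≤ A) :
    ∫⁻ x, gridMax τ p g x ∂V ≤ A := by
  classical
  set φ : Set (Fin n → ℝ) → (Fin n → ℝ) → ℝ≥0∞ :=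
    fun Q x => Q.indicator (fun _ => (∏ i, ⨍⁻ y in Q, g i y ∂volume) ^ p) x with hφ
  set D : ℤ × (Fin n → ℤ) → Set (Fin n → ℝ) := fun q => gridCube τ q.1 q.2 with hD
  have hφm : ∀ q, Measurable (φ (D q)) := fun q =>
    measurable_const.indicator (measurableSet_gridCube τ q.1 q.2)
  have heq : ∀ x, gridMax τ p g x =
      ⨆ s : Finset (ℤ × (Fin n → ℤ)), ⨆ q ∈ s, φ (D q) x :=
    fun x => iSup_eq_iSup_finset fun q => φ (D q) x
  simp_rw [heq]
  rw [lintegral_iSup_directed (f := fun (s : Finset (ℤ × (Fin n → ℤ))) x => ⨆ q ∈ s, φ (D q) x)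
    (fun s => (Measurable.biSup _ s.countable_toSet fun q _ => hφm q).aemeasurable)]
  · refine iSup_le fun s => ?_
    refine le_trans (le_of_eq ?_) (h (s.image D) ?_)
    · congr 1 with x
      rw [Finset.iSup_finset_image]
    · intro Q hQ
      obtain ⟨q, _, rfl⟩ := Finset.mem_image.1 (Finset.mem_coe.1 hQ)
      exact ⟨q, rfl⟩
  · intro s t
    refine ⟨s ∪ t, fun x => ?_, fun x => ?_⟩
    · exact biSup_mono fun q hq => Finset.mem_union_left _ hq
    · exact biSup_mono fun q hq => Finset.mem_union_right _ hq

/-- The shifts by `2 ^ K / 3` serve only scales up to `2 ^ K`. A fixed cube is captured by one of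
the `2 ^ n` grids for every large `K`, hence the lower limit; Fatou's lemma later removes it, as the
bounds are uniform in the translation. -/
theorem maximalFunction_rpow_le_liminf {p : ℝ} (hp : 0 < p) (g : Fin m → (Fin n → ℝ) → ℂ)
    (x : Fin n → ℝ) :
    maximalFunction g x ^ p ≤ Filter.liminf (fun K : ℕ => ((6 ^ n) ^ m) ^ p *
      ∑ α : Fin n → Bool, gridMax (thirdShift K α) p (fun i y => ‖g i y‖ₑ) x) Filter.atTop := by
  rw [← ENNReal.le_rpow_inv_iff hp]
  refine iSup₂_le fun a ℓ => iSup₂_le fun hℓ hx => ?_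
  rw [ENNReal.le_rpow_inv_iff hp]
  obtain ⟨j, hj, hj'⟩ := exists_zpow_two_side hℓ
  refine Filter.le_liminf_of_le (h := ?_)
  filter_upwards [Filter.eventually_ge_atTop j.toNat] with K hK
  obtain ⟨α, k, hsub⟩ := exists_cube_subset_gridCube (K := K) (by omega) hj a
  have hone : (∏ i, ⨍⁻ y in gridCube (thirdShift K α) j k, ‖g i y‖ₑ ∂volume) ^ p ≤
      gridMax (thirdShift K α) p (fun i y => ‖g i y‖ₑ) x := by
    refine le_trans (le_of_eq ?_) (le_iSup _ (j, k))
    rw [indicator_of_mem (hsub hx)]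
  calc (∏ i, (∫⁻ y in cube a ℓ, ‖g i y‖ₑ) / volume (cube a ℓ)) ^ p
      ≤ (∏ i, 6 ^ n * ⨍⁻ y in gridCube (thirdShift K α) j k, ‖g i y‖ₑ ∂volume) ^ p := by
        gcongr with i
        exact lintegral_cube_div_le hℓ hj' hsub
    _ = ((6 ^ n) ^ m) ^ p *
          (∏ i, ⨍⁻ y in gridCube (thirdShift K α) j k, ‖g i y‖ₑ ∂volume) ^ p := by
        rw [Finset.prod_mul_distrib, Finset.prod_const, Finset.card_univ, Fintype.card_fin,
          ENNReal.mul_rpow_of_nonneg _ _ hp.le]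
    _ ≤ _ := by
        gcongr
        exact hone.trans (Finset.single_le_sum (f := fun α : Fin n → Bool =>
          gridMax (thirdShift K α) p (fun i y => ‖g i y‖ₑ) x) (fun _ _ => zero_le)
          (Finset.mem_univ α))

theorem lintegral_maximalFunction_rpow_le {V : Measure (Fin n → ℝ)} {p : ℝ} (hp : 0 < p)
    {g : Fin m → (Fin n → ℝ) → ℂ} {A : ℝ≥0∞}
    (h : ∀ (τ : Fin n → ℝ) (𝒟 : Finset (Set (Fin n → ℝ))),
      (𝒟 : Set (Set (Fin n → ℝ))) ⊆ range (fun q : ℤ × (Fin n → ℤ) => gridCube τ q.1 q.2) →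
      ∫⁻ x, ⨆ Q ∈ 𝒟, Q.indicator (fun _ => (∏ i, ⨍⁻ y in Q, ‖g i y‖ₑ ∂volume) ^ p) x ∂V ≤ A) :
    ∫⁻ x, maximalFunction g x ^ p ∂V ≤ ((6 ^ n) ^ m) ^ p * (2 ^ n * A) := by
  have hmeas : ∀ K : ℕ, Measurable fun x => ∑ α : Fin n → Bool,
      gridMax (thirdShift K α) p (fun i y => ‖g i y‖ₑ) x := fun K =>
    Finset.measurable_sum _ fun α _ => measurable_gridMax _ _ _
  refine (lintegral_mono (maximalFunction_rpow_le_liminf hp g)).trans ?_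
  refine (lintegral_liminf_le fun K => (hmeas K).const_mul _).trans ?_
  refine (Filter.liminf_le_liminf (Filter.Eventually.of_forall fun K => ?_)).trans
    (Filter.liminf_const (f := Filter.atTop (α := ℕ)) _).le
  rw [lintegral_const_mul _ (hmeas K),
    lintegral_finsetSum _ fun α _ => measurable_gridMax _ _ _]
  gcongr
  refine (Finset.sum_le_card_nsmul _ _ A fun α _ => lintegral_gridMax_le (h _)).trans ?_
  simp

end GridMaximal

/-! ### Jensen's inequality and the weight condition. -/

section BumpCondition

variable {n m : ℕ}

/-- Jensen for the exponential. If `exp ∘ φ` is not integrable on `Q`, the right side is infinite.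
-/
theorem ofReal_exp_setAverage_le {X : Type*} [MeasurableSpace X] {μ : Measure X} {Q : Set X}
    (h0 : μ Q ≠ 0) (ht : μ Q ≠ ∞) {φ : X → ℝ} (hφ : IntegrableOn φ Q μ) :
    ENNReal.ofReal (Real.exp (⨍ x in Q, φ x ∂μ)) ≤
      ⨍⁻ x in Q, ENNReal.ofReal (Real.exp (φ x)) ∂μ := by
  have hnn : ∀ᵐ x ∂μ.restrict Q, 0 ≤ Real.exp (φ x) := ae_of_all _ fun x => (Real.exp_pos _).le
  by_cases hint : IntegrableOn (fun x => Real.exp (φ x)) Q μ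
  · rw [setLAverage_eq, ← ofReal_setAverage hint hnn]
    exact ENNReal.ofReal_le_ofReal (convexOn_exp.map_set_average_le
      Real.continuous_exp.continuousOn isClosed_univ h0 ht (by simp) hφ hint)
  · have htop : ∫⁻ x in Q, ENNReal.ofReal (Real.exp (φ x)) ∂μ = ∞ := by
      by_contra hne
      refine hint ⟨Real.continuous_exp.comp_aestronglyMeasurable hφ.aestronglyMeasurable, ?_⟩
      rw [hasFiniteIntegral_iff_ofReal hnn]
      exact Ne.lt_top hne
    rw [setLAverage_eq, htop, ENNReal.top_div_of_ne_top ht]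
    exact le_top

theorem integrableOn_of_bumpQuantity_ne_top {p : ℝ} {P : Fin m → ℝ} {v : (Fin n → ℝ) → ℝ}
    {u : Fin m → (Fin n → ℝ) → ℝ} {Q : Set (Fin n → ℝ)} (h : bumpQuantity p P v u Q ≠ ∞) :
    IntegrableOn v Q ∧ (∀ i, IntegrableOn (u i) Q) ∧
      IntegrableOn (fun x => Real.log (∏ i, u i x ^ (-p / P i))) Q := by
  by_contra hcon
  exact h (by rw [bumpQuantity, if_neg hcon])

/-- The exponential factor is moved to the other side, and Jensen is applied to `-ψ / 2` and
squared. This turns the geometric mean in the constant into an average of a square root. -/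
theorem weightMeasure_div_mul_le_bumpQuantity_mul {p : ℝ} (hp : 0 < p) {P : Fin m → ℝ}
    {v : (Fin n → ℝ) → ℝ} (hv : ∀ᵐ x, 0 ≤ v x)
    {u : Fin m → (Fin n → ℝ) → ℝ} (hu : ∀ i, ∀ᵐ x, 0 < u i x) {Q : Set (Fin n → ℝ)}
    (hQ : MeasurableSet Q) (h0 : volume Q ≠ 0) (ht : volume Q ≠ ∞)
    (hb : bumpQuantity p P v u Q ≠ ∞) :
    weightMeasure v Q / volume Q * (∏ i, ⨍⁻ y in Q, ENNReal.ofReal (u i y) ∂volume) ^ p ≤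
      bumpQuantity p P v u Q *
        (⨍⁻ y in Q, (∏ i, ENNReal.ofReal (u i y) ^ (p / P i)) ^ (1 / 2 : ℝ) ∂volume) ^ (2 : ℝ) := by
  obtain ⟨hvi, hui, hl⟩ := integrableOn_of_bumpQuantity_ne_top hb
  set ψ : (Fin n → ℝ) → ℝ := fun x => Real.log (∏ i, u i x ^ (-p / P i)) with hψ
  have hv' : 0 ≤ᵐ[volume.restrict Q] v := ae_restrict_of_ae hv
  have hu' : ∀ i, 0 ≤ᵐ[volume.restrict Q] u i := fun i =>
    ae_restrict_of_ae ((hu i).mono fun x hx => hx.le)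
  have hU0 : ∀ i, 0 ≤ ⨍ x in Q, u i x := fun i => by
    rw [setAverage_eq]
    exact smul_nonneg (by positivity) (integral_nonneg_of_ae (hu' i))
  have hA0 : 0 ≤ ⨍ x in Q, v x := by
    rw [setAverage_eq]
    exact smul_nonneg (by positivity) (integral_nonneg_of_ae hv')
  have hleft : weightMeasure v Q / volume Q *
      (∏ i, ⨍⁻ y in Q, ENNReal.ofReal (u i y) ∂volume) ^ p =
      ENNReal.ofReal ((⨍ x in Q, v x) * (∏ i, ⨍ x in Q, u i x) ^ p) := by
    rw [ENNReal.ofReal_mul hA0, ofReal_setAverage hvi hv',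
      ← ENNReal.ofReal_rpow_of_nonneg (Finset.prod_nonneg fun i _ => hU0 i) hp.le,
      ENNReal.ofReal_prod_of_nonneg fun i _ => hU0 i, weightMeasure, withDensity_apply _ hQ]
    congr 2
    refine Finset.prod_congr rfl fun i _ => ?_
    rw [ofReal_setAverage (hui i) (hu' i), setLAverage_eq]
  have hdens : ∀ᵐ x ∂volume.restrict Q,
      (∏ i, ENNReal.ofReal (u i x) ^ (p / P i)) ^ (1 / 2 : ℝ) =
        ENNReal.ofReal (Real.exp (-(1 / 2) * ψ x)) := by
    refine ae_restrict_of_ae ?_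
    filter_upwards [ae_all_iff.2 hu] with x hx
    have hprod : 0 < ∏ i, u i x ^ (p / P i) :=
      Finset.prod_pos fun i _ => Real.rpow_pos_of_pos (hx i) _
    have hinv : ∏ i, u i x ^ (-p / P i) = (∏ i, u i x ^ (p / P i))⁻¹ := by
      rw [← Finset.prod_inv_distrib]
      refine Finset.prod_congr rfl fun i _ => ?_
      rw [neg_div, Real.rpow_neg (hx i).le]
    have hreal : Real.exp (-(1 / 2) * ψ x) = (∏ i, u i x ^ (p / P i)) ^ (1 / 2 : ℝ) := by
      rw [hψ]
      simp only
      rw [hinv, Real.log_inv, Real.rpow_def_of_pos hprod]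
      ring_nf
    rw [hreal, ← ENNReal.ofReal_rpow_of_nonneg hprod.le (by norm_num),
      ENNReal.ofReal_prod_of_nonneg fun i _ => (Real.rpow_pos_of_pos (hx i) _).le]
    congr 1
    refine Finset.prod_congr rfl fun i _ => ?_
    rw [ENNReal.ofReal_rpow_of_pos (hx i)]
  have hjensen : ENNReal.ofReal (Real.exp (-⨍ x in Q, ψ x)) ≤
      (⨍⁻ y in Q, (∏ i, ENNReal.ofReal (u i y) ^ (p / P i)) ^ (1 / 2 : ℝ) ∂volume) ^ (2 : ℝ) := by
    have h1 := ofReal_exp_setAverage_le h0 ht (hl.const_mul (-(1 / 2)))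
    rw [laverage_congr hdens]
    refine le_trans (le_of_eq ?_) (ENNReal.rpow_le_rpow h1 zero_le_two)
    rw [ENNReal.ofReal_rpow_of_pos (Real.exp_pos _), ← Real.exp_mul, setAverage_eq, setAverage_eq,
      integral_const_mul]
    congr 2
    simp only [smul_eq_mul]
    ring
  rw [hleft]
  have hbq : bumpQuantity p P v u Q =
      ENNReal.ofReal ((⨍ x in Q, v x) * (∏ i, ⨍ x in Q, u i x) ^ p *
        Real.exp (⨍ x in Q, ψ x)) := by
    rw [bumpQuantity, if_pos ⟨hvi, hui, hl⟩]
  have hX0 : 0 ≤ (⨍ x in Q, v x) * (∏ i, ⨍ x in Q, u i x) ^ p :=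
    mul_nonneg hA0 (Real.rpow_nonneg (Finset.prod_nonneg fun i _ => hU0 i) _)
  calc ENNReal.ofReal ((⨍ x in Q, v x) * (∏ i, ⨍ x in Q, u i x) ^ p)
      = bumpQuantity p P v u Q * ENNReal.ofReal (Real.exp (-⨍ x in Q, ψ x)) := by
        rw [hbq, ← ENNReal.ofReal_mul (mul_nonneg hX0 (Real.exp_pos _).le), mul_assoc,
          ← Real.exp_add]
        simp
    _ ≤ _ := by gcongr

theorem bumpQuantity_congr_set {p : ℝ} {P : Fin m → ℝ} {v : (Fin n → ℝ) → ℝ}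
    {u : Fin m → (Fin n → ℝ) → ℝ} {Q R : Set (Fin n → ℝ)} (h : Q =ᵐ[volume] R) :
    bumpQuantity p P v u Q = bumpQuantity p P v u R := by
  unfold bumpQuantity IntegrableOn
  rw [Measure.restrict_congr_set h]

theorem bumpQuantity_gridCube_le (p : ℝ) (P : Fin m → ℝ) (v : (Fin n → ℝ) → ℝ)
    (u : Fin m → (Fin n → ℝ) → ℝ) (τ : Fin n → ℝ) (j : ℤ) (k : Fin n → ℤ) :
    bumpQuantity p P v u (gridCube τ j k) ≤ bumpConstant p P v u := by
  rw [bumpQuantity_congr_set (gridCube_ae_eq_cube τ j k)]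
  exact le_iSup₂_of_le (fun i => τ i + 2 ^ j * k i) (2 ^ j) (le_iSup_of_le (by positivity) le_rfl)

end BumpCondition

/-! ### Assembly of the strong type bound. -/

section StrongType

variable {n m : ℕ}

/-- The constant in the strong type inequality for the `p`-th power of the maximal function. -/
noncomputable def strongConst (n : ℕ) {m : ℕ} (p : ℝ) (P : Fin m → ℝ) : ℝ≥0∞ :=
  ((6 ^ n) ^ m) ^ p * (2 ^ n * laminarConst p P)

/-- Measurable representatives replace `u i` and `‖f i‖ₑ`. The latter agree only almost everywhere
for the weighted measure; positivity of `u i` transfers this to Lebesgue measure. -/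
theorem lintegral_maximalFunction_le_bumpConstant (hm0 : m ≠ 0) {P : Fin m → ℝ}
    (hP : ∀ i, 1 < P i) {p : ℝ} (hp : 0 < p) (hsum : ∑ i, p / P i = 1)
    {v : (Fin n → ℝ) → ℝ} (hv : ∀ᵐ x, 0 ≤ v x)
    {u : Fin m → (Fin n → ℝ) → ℝ} (hum : ∀ i, AEMeasurable (u i))
    (hu : ∀ i, ∀ᵐ x, 0 < u i x) (hb : bumpConstant p P v u ≠ ∞)
    {f : Fin m → (Fin n → ℝ) → ℂ}
    (hf : ∀ i, AEStronglyMeasurable (f i) (weightMeasure (u i)))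
    (hint : ∀ i, ∫⁻ x, ‖f i x‖ₑ ^ P i ∂(weightMeasure (u i)) ≠ ∞) :
    ∫⁻ x, maximalFunction (fun i x => f i x * (u i x : ℂ)) x ^ p ∂(weightMeasure v) ≤
      strongConst n p P * bumpConstant p P v u *
        ∏ i, (∫⁻ x, ‖f i x‖ₑ ^ P i ∂(weightMeasure (u i))) ^ (p / P i) := by
  have hsm : ∀ i, AEMeasurable (fun x => ENNReal.ofReal (u i x)) := fun i => (hum i).ennreal_ofReal
  have hs0 : ∀ i, ∀ᵐ x, ENNReal.ofReal (u i x) ≠ 0 := fun i =>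
    (hu i).mono fun x hx => by simpa using hx
  have hac : ∀ i, volume ≪ weightMeasure (u i) := fun i =>
    withDensity_absolutelyContinuous' (hsm i) (hs0 i)
  set s : Fin m → (Fin n → ℝ) → ℝ≥0∞ := fun i => (hsm i).mk with hsdef
  have hs : ∀ i, Measurable (s i) := fun i => (hsm i).measurable_mk
  have hsu : ∀ i, (fun x => ENNReal.ofReal (u i x)) =ᵐ[volume] s i := fun i => (hsm i).ae_eq_mk
  have hN : ∀ i, weightMeasure (u i) = volume.withDensity (s i) := fun i =>
    withDensity_congr_ae (hsu i)
  set F : Fin m → (Fin n → ℝ) → ℝ≥0∞ := fun i => (hf i).enorm.mk with hFdef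
  have hF : ∀ i, Measurable (F i) := fun i => (hf i).enorm.measurable_mk
  have hfF : ∀ i, (fun x => ‖f i x‖ₑ) =ᵐ[weightMeasure (u i)] F i := fun i =>
    (hf i).enorm.ae_eq_mk
  have hFint : ∀ i, ∫⁻ x, ‖f i x‖ₑ ^ P i ∂(weightMeasure (u i)) =
      ∫⁻ x, F i x ^ P i ∂(volume.withDensity (s i)) := fun i => by
    rw [← hN i]
    exact lintegral_congr_ae ((hfF i).mono fun x hx => by simp only [hx])
  have hg : ∀ i, (fun x => ‖f i x * (u i x : ℂ)‖ₑ) =ᵐ[volume] fun x => s i x * F i x := by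
    intro i
    filter_upwards [hu i, hsu i, (hac i).ae_eq (hfF i)] with x h1 h2 h3
    have h4 : ‖(u i x : ℂ)‖ₑ = ENNReal.ofReal (u i x) := by
      rw [← ofReal_norm, Complex.norm_real, Real.norm_of_nonneg h1.le]
    rw [enorm_mul, h4, h2, h3, mul_comm]
  simp_rw [hFint] at hint ⊢
  refine (lintegral_maximalFunction_rpow_le hp (A := laminarConst p P * bumpConstant p P v u *
    ∏ i, (∫⁻ x, F i x ^ P i ∂(volume.withDensity (s i))) ^ (p / P i))
    fun τ 𝒟 h𝒟 => ?_).trans_eq (by rw [strongConst]; ring)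
  have hcube : ∀ Q ∈ 𝒟, MeasurableSet Q ∧ volume Q ≠ 0 ∧ volume Q ≠ ∞ ∧
      bumpQuantity p P v u Q ≤ bumpConstant p P v u := by
    intro Q hQ
    obtain ⟨q, rfl⟩ := h𝒟 hQ
    refine ⟨measurableSet_gridCube _ _ _, ?_, ?_, bumpQuantity_gridCube_le _ _ _ _ _ _ _⟩
    · rw [volume_gridCube]
      refine pow_ne_zero _ ?_
      rw [Ne, ENNReal.ofReal_eq_zero, not_le]
      positivity
    · rw [volume_gridCube]
      exact ENNReal.pow_ne_top ENNReal.ofReal_ne_top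
  have hqt : ∀ Q ∈ 𝒟, bumpQuantity p P v u Q ≠ ∞ := fun Q hQ =>
    ne_top_of_le_ne_top hb (hcube Q hQ).2.2.2
  have key := lintegral_iSup_prod_setLAverage_rpow_le (μ := volume) (V := weightMeasure v)
    (B := bumpConstant p P v u)
    ((isLaminar_range_gridCube τ).mono h𝒟) (fun Q hQ => (hcube Q hQ).1)
    (fun Q hQ => (hcube Q hQ).2.1) (fun Q hQ => (hcube Q hQ).2.2.1) hm0 hP hp hsum hs hF
    (fun i Q hQ h => (hcube Q hQ).2.1 (hac i (by rw [hN i]; exact h)))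
    (fun i Q hQ => by
      rw [← hN i, weightMeasure, withDensity_apply _ (hcube Q hQ).1]
      exact ((integrableOn_of_bumpQuantity_ne_top (hqt Q hQ)).2.1 i).lintegral_lt_top.ne)
    hint ?_
  · refine le_trans (le_of_eq ?_) key
    congr 1 with x
    refine iSup_congr fun Q => iSup_congr fun hQ => ?_
    congr 1
    ext
    congr 1
    exact Finset.prod_congr rfl fun i _ => laverage_congr (ae_restrict_of_ae (hg i))
  · intro Q hQ
    have h1 := weightMeasure_div_mul_le_bumpQuantity_mul (P := P) hp hv hu (hcube Q hQ).1 (hcube Q hQ).2.1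
      (hcube Q hQ).2.2.1 (hqt Q hQ)
    have h2 : ∀ i, ⨍⁻ y in Q, ENNReal.ofReal (u i y) ∂volume = ⨍⁻ y in Q, s i y ∂volume :=
      fun i => laverage_congr (ae_restrict_of_ae (hsu i))
    have h3 : ⨍⁻ y in Q, (∏ i, ENNReal.ofReal (u i y) ^ (p / P i)) ^ (1 / 2 : ℝ) ∂volume =
        ⨍⁻ y in Q, (∏ i, s i y ^ (p / P i)) ^ (1 / 2 : ℝ) ∂volume := by
      refine laverage_congr (ae_restrict_of_ae ?_)
      filter_upwards [ae_all_iff.2 hsu] with x hx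
      simp only [hx]
    simp_rw [h2, h3] at h1
    exact h1.trans (by gcongr; exact (hcube Q hQ).2.2.2)

theorem maximalFunction_eq_zero {g : Fin m → (Fin n → ℝ) → ℂ} {i : Fin m}
    (hi : ∀ᵐ x, g i x = 0) : maximalFunction g = 0 := by
  funext x
  simp only [maximalFunction, Pi.zero_apply, ENNReal.iSup_eq_zero]
  intro a ℓ _ _
  refine Finset.prod_eq_zero (Finset.mem_univ i) ?_
  rw [ENNReal.div_eq_zero_iff]
  left
  rw [lintegral_congr_ae (ae_restrict_of_ae (hi.mono fun y hy => by rw [hy, enorm_zero]))]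
  simp

theorem strongConst_ne_top (n : ℕ) {P : Fin m → ℝ} {p : ℝ} (hp : 0 < p) :
    strongConst n p P ≠ ∞ := by
  have h : ∀ {x : ℝ≥0∞} {q : ℝ}, 0 ≤ q → x ≠ ∞ → x ^ q ≠ ∞ := fun hq hx =>
    ENNReal.rpow_ne_top_of_nonneg hq hx
  refine ENNReal.mul_ne_top (h hp.le (by finiteness)) (ENNReal.mul_ne_top (by finiteness) ?_)
  refine ENNReal.mul_ne_top (h hp.le (by finiteness)) (ENNReal.mul_ne_top (ENNReal.mul_ne_top
    (by finiteness) (h zero_le_two ENNReal.ofReal_ne_top)) ?_)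
  exact ENNReal.prod_ne_top fun i _ => h hp.le ENNReal.ofReal_ne_top

/-- Needed when the weight constant is infinite, so that its product with the constant is still
infinite. -/
theorem strongConst_ne_zero (n : ℕ) {P : Fin m → ℝ} (hP : ∀ i, 1 < P i) {p : ℝ} (hp : 0 < p) :
    strongConst n p P ≠ 0 := by
  have h : ∀ {x : ℝ≥0∞} {q : ℝ}, 0 < q → x ≠ 0 → x ^ q ≠ 0 := fun hq hx h => by
    rw [ENNReal.rpow_eq_zero_iff] at h
    rcases h with h | h
    · exact hx h.1
    · exact absurd h.2 hq.not_gt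
  have hr : ∀ {r : ℝ}, 0 < r → ENNReal.ofReal r ≠ 0 := fun hr => by simpa using hr
  refine mul_ne_zero (h hp (by positivity)) (mul_ne_zero (by positivity) ?_)
  refine mul_ne_zero (h hp (by positivity)) (mul_ne_zero (mul_ne_zero
    (by positivity) (h zero_lt_two (hr (by norm_num)))) ?_)
  refine Finset.prod_ne_zero_iff.2 fun i _ => h hp (hr ?_)
  exact div_pos (zero_lt_one.trans (hP i)) (sub_pos.2 (hP i))

end StrongType

end MultiWeight

theorem theorem3p3 (n m : ℕ) (hn : 1 ≤ n) (hm : 1 ≤ m) (P : Fin m → ℝ) (hP : ∀ i, 1 < P i)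
    (p : ℝ) (hp : 1 / p = ∑ i, 1 / P i) :
    ∃ C : NNReal, ∀ (v : (Fin n → ℝ) → ℝ) (w : Fin m → (Fin n → ℝ) → ℝ),
      MultiWeight.IsWeight v → (∀ i, MultiWeight.IsWeight (w i)) →
      (∀ i, ∀ᵐ x, 0 < w i x) →
      ∀ f : Fin m → (Fin n → ℝ) → ℂ,
        (∀ i, MeasureTheory.MemLp (f i) (ENNReal.ofReal (P i))
          (MultiWeight.weightMeasure (MultiWeight.dualWeight (P i) (w i)))) →
        MeasureTheory.eLpNorm
            (MultiWeight.maximalFunction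
              (fun i x => f i x * (MultiWeight.dualWeight (P i) (w i) x : ℂ)))
            (ENNReal.ofReal p) (MultiWeight.weightMeasure v)
          ≤ C * MultiWeight.bumpConstant p P v
                (fun i => MultiWeight.dualWeight (P i) (w i)) ^ (1 / p) *
              ∏ i, MeasureTheory.eLpNorm (f i) (ENNReal.ofReal (P i))
                (MultiWeight.weightMeasure (MultiWeight.dualWeight (P i) (w i))) := by
  have hm0 : m ≠ 0 := by omega
  have hP0 : ∀ i, 0 < P i := fun i => zero_lt_one.trans (hP i)
  have hp0 : 0 < p := by
    rw [← one_div_pos, hp]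
    exact Finset.sum_pos (fun i _ => one_div_pos.2 (hP0 i)) ⟨⟨0, by omega⟩, Finset.mem_univ _⟩
  have hsum : ∑ i, p / P i = 1 := by
    simp_rw [div_eq_mul_one_div p]
    rw [← Finset.mul_sum, ← hp, mul_one_div_cancel hp0.ne']
  have hip : 0 < 1 / p := one_div_pos.2 hp0
  have hCtop : MultiWeight.strongConst n p P ^ (1 / p) ≠ ⊤ :=
    ENNReal.rpow_ne_top_of_nonneg hip.le (MultiWeight.strongConst_ne_top n hp0)
  have hC0 : MultiWeight.strongConst n p P ^ (1 / p) ≠ 0 := by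
    rw [Ne, ENNReal.rpow_eq_zero_iff]
    simp [MultiWeight.strongConst_ne_zero n hP hp0, MultiWeight.strongConst_ne_top n hp0]
  refine ⟨(MultiWeight.strongConst n p P ^ (1 / p)).toNNReal, fun v w hv hw hwpos f hf => ?_⟩
  rw [ENNReal.coe_toNNReal hCtop]
  set u : Fin m → (Fin n → ℝ) → ℝ := fun i => MultiWeight.dualWeight (P i) (w i) with hudef
  have hum : ∀ i, AEMeasurable (u i) := fun i =>
    (hw i).locallyIntegrable.aestronglyMeasurable.aemeasurable.pow_const _
  have hu : ∀ i, ∀ᵐ x, 0 < u i x := fun i => (hwpos i).mono fun x hx => Real.rpow_pos_of_pos hx _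
  have hac : ∀ i, MeasureTheory.Measure.AbsolutelyContinuous MeasureTheory.volume
      (MultiWeight.weightMeasure (u i)) := fun i =>
    MeasureTheory.withDensity_absolutelyContinuous' (hum i).ennreal_ofReal
      ((hu i).mono fun x hx => by simpa using hx)
  have hnorm : ∀ i, MeasureTheory.eLpNorm (f i) (ENNReal.ofReal (P i))
      (MultiWeight.weightMeasure (u i)) =
        (∫⁻ x, ‖f i x‖ₑ ^ P i ∂(MultiWeight.weightMeasure (u i))) ^ (1 / P i) := fun i => by
    rw [MeasureTheory.eLpNorm_eq_lintegral_rpow_enorm_toReal (by simpa using hP0 i)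
      ENNReal.ofReal_ne_top, ENNReal.toReal_ofReal (hP0 i).le]
  -- With an infinite constant, either some `f i` vanishes almost everywhere and both sides are zero
  -- by `∞ · 0 = 0`, or the right side is infinite.
  by_cases hb : MultiWeight.bumpConstant p P v u = ⊤
  · by_cases hzero : ∃ i, MeasureTheory.eLpNorm (f i) (ENNReal.ofReal (P i))
        (MultiWeight.weightMeasure (u i)) = 0
    · obtain ⟨i, hi⟩ := hzero
      rw [MeasureTheory.eLpNorm_eq_zero_iff (hf i).1 (by simpa using hP0 i)] at hi
      rw [MultiWeight.maximalFunction_eq_zero (i := i)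
        (((hac i).ae_eq hi).mono fun x hx => by simp [hx])]
      simp
    · push Not at hzero
      rw [hb, ENNReal.top_rpow_of_pos hip, ENNReal.mul_top hC0,
        ENNReal.top_mul (Finset.prod_ne_zero_iff.2 fun i _ => hzero i)]
      exact le_top
  · have hint : ∀ i, ∫⁻ x, ‖f i x‖ₑ ^ P i ∂(MultiWeight.weightMeasure (u i)) ≠ ⊤ := by
      intro i htop
      have h := (hf i).2.ne
      rw [hnorm i, htop, ENNReal.top_rpow_of_pos (one_div_pos.2 (hP0 i))] at h
      exact h rfl
    have key := MultiWeight.lintegral_maximalFunction_le_bumpConstant hm0 hP hp0 hsum hv.nonneg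
      hum hu hb (fun i => (hf i).1) hint
    rw [MeasureTheory.eLpNorm_eq_lintegral_rpow_enorm_toReal (by simpa using hp0)
      ENNReal.ofReal_ne_top, ENNReal.toReal_ofReal hp0.le]
    rw [Finset.prod_congr rfl fun i _ => hnorm i]
    simp only [enorm_eq_self]
    refine (ENNReal.rpow_le_rpow key hip.le).trans_eq ?_
    rw [ENNReal.mul_rpow_of_nonneg _ _ hip.le, ENNReal.mul_rpow_of_nonneg _ _ hip.le,
      ← ENNReal.prod_rpow_of_nonneg hip.le]
    congr 1
    refine Finset.prod_congr rfl fun i _ => ?_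
    rw [← ENNReal.rpow_mul]
    congr 1
    field_simp
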